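/- Let $G$ be a finite simple graph with vertex set $V$, and let $CG$ be its cone: the graph with vertex set $V\cup\{\bullet\}$ obtained from $G$ by joining a new vertex $\bullet$ to every vertex of $G$. For $r>0$, an $r$-circular coloring of a graph $H$ is a map $f$ from the vertices of $H$ to $\mathbb{R}P^1$, the circle of circumference $\pi$, such that $d(f(v),f(w))\ge \pi/r$ for every edge $vw$; the circular chromatic number is $\chi_c(H)=\inf\{r>0 : H \text{ is } r\text{-circular colorable}\}$. The box complex $B_0(H)$ is the simplicial complex whose vertices are $+v$ and $-v$ for the vertices $v$ of $H$, and in which a nonempty set $\sigma$ of vertices is a face if and only if $vw$ is an edge of $H$ whenever $+v\in\sigma$ and $-w\in\sigma$. Its geometric realization carries the $\mathbb{Z}/2$-action that extends $+v\leftrightarrow -v$ linearly; spheres carry the antipodal action; a map is odd if it commutes with these actions. Here $S^{-1}=\emptyset$. 1. Let $k\ge 0$ be an integer, and suppose that $k\ge 1$ or $G$ has at least one vertex. If there is a continuous odd map $S^{2k}\to B_0(CG)$, then $\chi_c(CG)\ge 2k+1$. 2. $B_0(CG)$ is the simplicial suspension of $B_0(G)$ with poles $+\bullet$ and $-\bullet$: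 a nonempty set $\sigma$ of vertices of $B_0(CG)$ is a face if and only if it does not contain both $+\bullet$ and $-\bullet$, and $\sigma\setminus\{+\bullet,-\bullet\}$ is empty or a face of $B_0(G)$. The $\mathbb{Z}/2$-action on the vertices of $B_0(CG)$ extends that of $B_0(G)$ and exchanges the two poles. 3. For every integer $d\ge -1$, if there is a continuous odd map $S^{d}\to B_0(G)$, then there is a continuous odd map $S^{d+1}\to B_0(CG)$. In other words, $\mathrm{coind}(B_0(CG))\ge\mathrm{coind}(B_0(G))+1$. 4. (Simonyi--Tardos) For every integer $k\ge 0$, if there is a continuous odd map $S^{2k-1}\to B_0(G)$, then $\chi_c(G)\ge 2k$. -/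

import Mathlib

/-- The cone over a graph: a new vertex `none` joined to every old vertex `some v`. -/
def coneGraph {V : Type*} (G : SimpleGraph V) : SimpleGraph (Option V) where
  Adj x y :=
    match x, y with
    | none, none => False
    | none, some _ => True
    | some _, none => True
    | some v, some w => G.Adj v w
  symm := ⟨fun x y h => by
    cases x <;> cases y <;> first | exact h.symm | trivial⟩
  loopless := ⟨fun x h => by
    cases x
    · exact h
    · exact G.loopless.irrefl _ h⟩

/-- An `r`-circular coloring: a map to `ℝP¹`, the circle of circumference `π` with its arc-length
metric, sending adjacent vertices to points at distance at least `π / r`. -/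
def IsCircularColoring {V : Type*} (G : SimpleGraph V) (r : ℝ) (f : V → AddCircle Real.pi) :
    Prop :=
  ∀ v w, G.Adj v w → Real.pi / r ≤ dist (f v) (f w)

/-- The set of all `r > 0` such that `G` is `r`-circular colorable. -/
def circularColorableSet {V : Type*} (G : SimpleGraph V) : Set ℝ :=
  {r | 0 < r ∧ ∃ f : V → AddCircle Real.pi, IsCircularColoring G r f}

/-- The circular chromatic number of a (finite) graph. -/
noncomputable def circularChromaticNumber {V : Type*} (G : SimpleGraph V) : ℝ :=
  sInf (circularColorableSet G)

theorem circularColorableSet_bddBelow {V : Type*} (G : SimpleGraph V) :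
    BddBelow (circularColorableSet G) :=
  ⟨0, fun _ h => h.1.le⟩

/-- For a finite graph the infimum defining the circular chromatic number is that of a nonempty
set. -/
theorem circularColorableSet_nonempty {V : Type*} [Finite V] (G : SimpleGraph V) :
    (circularColorableSet G).Nonempty := by
  have hpi := Real.pi_pos
  have : Fact (0 < Real.pi) := ⟨hpi⟩
  have : Infinite (AddCircle Real.pi) := by
    have : Infinite (Set.Ico (0 : ℝ) (0 + Real.pi)) :=
      (Set.Ico_infinite (by linarith)).to_subtype
    exact Infinite.of_injective _ (AddCircle.equivIco Real.pi 0).symm.injective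
  obtain ⟨n, ⟨e⟩⟩ := Finite.exists_equiv_fin V
  let f : V → AddCircle Real.pi := fun v => Infinite.natEmbedding _ (e v : ℕ)
  have hf : Function.Injective f := fun v w h => by
    exact e.injective (Fin.ext ((Infinite.natEmbedding (AddCircle Real.pi)).injective h))
  have key : ∃ δ > 0, ∀ p : V × V, p.1 ≠ p.2 → δ ≤ dist (f p.1) (f p.2) := by
    have h1 : ∀ p : V × V, ∀ᶠ δ in nhdsWithin (0 : ℝ) (Set.Ioi 0),
        p.1 ≠ p.2 → δ ≤ dist (f p.1) (f p.2) := by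
      intro p
      by_cases hp : p.1 = p.2
      · simp [hp]
      · have hd : 0 < dist (f p.1) (f p.2) := dist_pos.2 (hf.ne hp)
        filter_upwards [Ioc_mem_nhdsGT hd] with δ hδ _ using hδ.2
    have h2 := Filter.eventually_all.2 h1
    obtain ⟨δ, hδ, hpos⟩ := (h2.and self_mem_nhdsWithin).exists
    exact ⟨δ, hpos, hδ⟩
  obtain ⟨δ, hδ, h⟩ := key
  refine ⟨Real.pi / δ, by positivity, f, fun v w hvw => ?_⟩
  rw [div_div_cancel₀ hpi.ne']
  exact h (v, w) hvw.ne

/-- The box complex `B₀(G)`. Its vertices are `Sum.inl v` (positive copy of `v`) and `Sum.inr v`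
(negative copy of `v`); a nonempty finite set of vertices is a face iff every positive vertex in
it is adjacent in `G` to every negative vertex in it. -/
def boxComplex {V : Type*} (G : SimpleGraph V) : AbstractSimplicialComplex (V ⊕ V) where
  faces := {σ | σ.Nonempty ∧ ∀ v w, Sum.inl v ∈ σ → Sum.inr w ∈ σ → G.Adj v w}
  isRelLowerSet_faces := fun _ hσ =>
    ⟨hσ.1, fun _ hτ hne => ⟨hne, fun v w hv hw => hσ.2 v w (hτ hv) (hτ hw)⟩⟩
  singleton_mem := fun x => ⟨Finset.singleton_nonempty x, fun v w hv hw => by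
    rw [Finset.mem_singleton] at hv hw
    exact absurd (hv.trans hw.symm) (by simp)⟩

/-- The geometric realization of a simplicial complex on a finite vertex set: the union, over all
faces `σ`, of the closed simplices spanned by `σ` inside the standard simplex. -/
def geomRealization {ι : Type*} [Fintype ι] (K : AbstractSimplicialComplex ι) : Set (ι → ℝ) :=
  {x | x ∈ stdSimplex ℝ ι ∧ ∃ σ ∈ K.faces, ∀ i, i ∉ σ → x i = 0}

/-- The topological space underlying the box complex of a finite graph. -/
def BoxSpace {V : Type*} [Fintype V] (G : SimpleGraph V) : Type _ :=
  geomRealization (boxComplex G)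

instance {V : Type*} [Fintype V] (G : SimpleGraph V) : TopologicalSpace (BoxSpace G) :=
  inferInstanceAs (TopologicalSpace (geomRealization (boxComplex G)))

theorem swap_mem_geomRealization {V : Type*} [Fintype V] (G : SimpleGraph V) {x : V ⊕ V → ℝ}
    (hx : x ∈ geomRealization (boxComplex G)) :
    (fun i => x i.swap) ∈ geomRealization (boxComplex G) := by
  obtain ⟨⟨h0, h1⟩, σ, ⟨⟨i, hi⟩, hσ⟩, hs⟩ := hx
  refine ⟨⟨fun i => h0 _, ?_⟩, σ.map (Equiv.sumComm V V).toEmbedding, ⟨?_, ?_⟩, ?_⟩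
  · rw [← h1]
    exact Equiv.sum_comp (Equiv.sumComm V V) x
  · exact ⟨i.swap, Finset.mem_map.2 ⟨i, hi, rfl⟩⟩
  · intro v w hv hw
    simp only [Finset.mem_map_equiv, Equiv.sumComm_symm, Equiv.sumComm_apply, Sum.swap_inl,
      Sum.swap_inr] at hv hw
    exact (hσ w v hw hv).symm
  · intro i hi
    refine hs _ fun h => hi ?_
    simpa [Finset.mem_map_equiv] using h

/-- The `ℤ/2`-action on the box complex: the linear extension of the exchange of the positive and
the negative copy of every vertex. -/
instance {V : Type*} [Fintype V] (G : SimpleGraph V) : Neg (BoxSpace G) :=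
  ⟨fun x => ⟨fun i => x.1 i.swap, swap_mem_geomRealization G x.2⟩⟩

/-- The unit sphere `S^(n-1)` of Euclidean space `ℝⁿ`; it carries Mathlib's antipodal map. -/
abbrev UnitSphere (n : ℕ) : Type :=
  Metric.sphere (0 : EuclideanSpace ℝ (Fin n)) 1

/-- There is a continuous odd (that is, `ℤ/2`-equivariant) map `X → Y`. -/
def HasOddMap (X Y : Type*) [TopologicalSpace X] [TopologicalSpace Y] [Neg X] [Neg Y] : Prop :=
  ∃ f : X → Y, Continuous f ∧ Function.Odd f

/-- The suspension of a simplicial complex `K`: its join with two isolated points, the poles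
`Sum.inr true` and `Sum.inr false`. A nonempty set of vertices is a face iff its part in `K` is
empty or a face of `K` and it contains at most one pole. -/
def simplicialSuspension {ι : Type*} (K : AbstractSimplicialComplex ι) :
    AbstractSimplicialComplex (ι ⊕ Bool) where
  faces := {σ | σ.Nonempty ∧ (σ.toLeft = ∅ ∨ σ.toLeft ∈ K.faces) ∧
    ¬(Sum.inr true ∈ σ ∧ Sum.inr false ∈ σ)}
  isRelLowerSet_faces := fun σ hσ => ⟨hσ.1, fun τ hτ hne => by
    refine ⟨hne, ?_, fun h => hσ.2.2 ⟨hτ h.1, hτ h.2⟩⟩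
    have hsub : τ.toLeft ⊆ σ.toLeft := fun a ha =>
      Finset.mem_toLeft.2 (hτ (Finset.mem_toLeft.1 ha))
    rcases Finset.eq_empty_or_nonempty τ.toLeft with h | h
    · exact Or.inl h
    · rcases hσ.2.1 with h' | h'
      · exact absurd (Finset.subset_empty.1 (h' ▸ hsub)) h.ne_empty
      · exact Or.inr ((K.isRelLowerSet_faces h').2 hsub h)⟩
  singleton_mem := fun x => by
    cases x with
    | inl a =>
      have h : ({Sum.inl a} : Finset (ι ⊕ Bool)).toLeft = {a} := by ext; simp
      exact ⟨Finset.singleton_nonempty _, Or.inr (h ▸ K.singleton_mem a), by simp⟩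
    | inr b =>
      have h : ({Sum.inr b} : Finset (ι ⊕ Bool)).toLeft = ∅ := by ext; simp
      exact ⟨Finset.singleton_nonempty _, Or.inl h, by cases b <;> simp⟩

/-- The signed vertices of the cone: those of `G`, and the two signed copies of the apex, which
serve as the poles. -/
def coneSignedVertexEquiv (V : Type*) : Option V ⊕ Option V ≃ (V ⊕ V) ⊕ Bool where
  toFun
    | Sum.inl (some v) => Sum.inl (Sum.inl v)
    | Sum.inr (some v) => Sum.inl (Sum.inr v)
    | Sum.inl none => Sum.inr true
    | Sum.inr none => Sum.inr false
  invFun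
    | Sum.inl (Sum.inl v) => Sum.inl (some v)
    | Sum.inl (Sum.inr v) => Sum.inr (some v)
    | Sum.inr true => Sum.inl none
    | Sum.inr false => Sum.inr none
  left_inv x := by rcases x with (_ | v) | (_ | v) <;> rfl
  right_inv x := by rcases x with (v | v) | (_ | _) <;> rfl

/-! ### Ordered chains with coefficients in `ℤ/2` -/

/-! The lower bounds rest on the Borsuk–Ulam theorem, proved here through a mod 2 version of
Tucker's lemma (`no_complementary_free_labelling`, `exists_zero_of_odd`), and on the moment curve.
Cut the circle open, so that a coloring gives each vertex `v` a position `t v` on a line. A point of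
the box complex is a signed measure on the vertices, and vertices of opposite sign are adjacent.
Along an odd map from the sphere of dimension `d + 1`, the first `d + 1` moments of this measure
form an odd map to Euclidean space of dimension `d + 1`, so they vanish at some point. A nonzero
measure with these moments zero changes sign at least `d + 1` times, since otherwise a polynomial of
degree at most `d` would match its signs. This gives `d + 2` vertices with strictly monotone
positions and alternating signs.

Consecutive vertices of the sequence are adjacent, hence at least `π / r` apart. If their number is
even, the two ends have opposite signs and are adjacent, so the arc closing the circle is also at
least `π / r`; this is the Simonyi–Tardos bound. In a cone the number may be odd: rotate the apex to
the cut point, and its adjacency to the top vertex of the sequence supplies the last arc.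

The suspension statement is a case check on the apex. The coindex statement uses the explicit
suspension of an odd map, with the last coordinate of the sphere as weight on the poles. -/

/-- Ordered simplicial chains modulo two: formal sums of finite sequences of points. -/
abbrev OrderedChain (X : Type*) := List X →₀ ZMod 2

namespace OrderedChain

variable {X Y : Type*}

/-- The chain consisting of one ordered simplex. -/
noncomputable abbrev simplex (l : List X) : OrderedChain X := Finsupp.single l 1

/-- The linear extension of a map of ordered simplices. -/
noncomputable abbrev push (f : List X → List Y) : OrderedChain X →ₗ[ZMod 2] OrderedChain Y :=
  Finsupp.lmapDomain (ZMod 2) (ZMod 2) f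

/-- The chains all of whose simplices lie in `s`. -/
noncomputable abbrev supportedOn (s : Set (List X)) : Submodule (ZMod 2) (OrderedChain X) :=
  Finsupp.supported (ZMod 2) (ZMod 2) s

/-- The linear extension of a function on ordered simplices. -/
noncomputable abbrev extend {M : Type*} [AddCommGroup M] [Module (ZMod 2) M] (f : List X → M) :
    OrderedChain X →ₗ[ZMod 2] M :=
  Finsupp.linearCombination (ZMod 2) f

theorem extend_simplex {M : Type*} [AddCommGroup M] [Module (ZMod 2) M] (f : List X → M)
    (l : List X) : extend f (simplex l) = f l := by
  simp [Finsupp.linearCombination_single]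

theorem push_simplex (f : List X → List Y) (l : List X) :
    push f (simplex l) = simplex (f l) := by
  simp [Finsupp.lmapDomain_apply, Finsupp.mapDomain_single]

theorem add_self (c : OrderedChain X) : c + c = 0 := by
  ext l
  exact CharTwo.add_self_eq_zero (c l)

theorem simplex_mem {s : Set (List X)} {l : List X} (h : l ∈ s) : simplex l ∈ supportedOn s :=
  Finsupp.single_mem_supported _ _ h

theorem eqOn_supported {M : Type*} [AddCommGroup M] [Module (ZMod 2) M]
    {f g : OrderedChain X →ₗ[ZMod 2] M} {s : Set (List X)}
    (h : ∀ l ∈ s, f (simplex l) = g (simplex l)) {c : OrderedChain X} (hc : c ∈ supportedOn s) :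
    f c = g c := by
  rw [supportedOn, Finsupp.supported_eq_span_single] at hc
  refine LinearMap.eqOn_span ?_ hc
  rintro _ ⟨l, hl, rfl⟩
  exact h l hl

theorem ext_simplex {M : Type*} [AddCommGroup M] [Module (ZMod 2) M]
    {f g : OrderedChain X →ₗ[ZMod 2] M} (h : ∀ l, f (simplex l) = g (simplex l))
    (c : OrderedChain X) : f c = g c :=
  eqOn_supported (s := Set.univ) (fun l _ => h l) (by simp [supportedOn, Finsupp.supported_univ])

theorem map_supported {f : OrderedChain X →ₗ[ZMod 2] OrderedChain Y} {s : Set (List X)}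
    {t : Set (List Y)} (h : ∀ l ∈ s, f (simplex l) ∈ supportedOn t) {c : OrderedChain X}
    (hc : c ∈ supportedOn s) : f c ∈ supportedOn t := by
  rw [supportedOn, Finsupp.supported_eq_span_single] at hc
  have : Submodule.span (ZMod 2) ((fun i => Finsupp.single i (1 : ZMod 2)) '' s) ≤
      (supportedOn t).comap f := by
    rw [Submodule.span_le]
    rintro _ ⟨l, hl, rfl⟩
    exact h l hl
  exact this hc

theorem push_supported {f : List X → List Y} {s : Set (List X)} {t : Set (List Y)}
    (h : ∀ l ∈ s, f l ∈ t) {c : OrderedChain X} (hc : c ∈ supportedOn s) :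
    push f c ∈ supportedOn t :=
  map_supported (fun l hl => by rw [push_simplex]; exact simplex_mem (h l hl)) hc

/-- The cone with apex `x`. -/
noncomputable abbrev cone (x : X) : OrderedChain X →ₗ[ZMod 2] OrderedChain X :=
  push (List.cons x)

/-- The (augmented) boundary of an ordered simplex: the sum of its facets. -/
noncomputable def boundaryList : List X → OrderedChain X
  | [] => 0
  | x :: l => simplex l + cone x (boundaryList l)

/-- The augmented boundary operator. -/
noncomputable def boundary : OrderedChain X →ₗ[ZMod 2] OrderedChain X := extend boundaryList

theorem boundary_simplex (l : List X) : boundary (simplex l) = boundaryList l :=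
  extend_simplex _ _

theorem boundary_simplex_nil : boundary (simplex ([] : List X)) = 0 := boundary_simplex _

theorem boundary_simplex_cons (x : X) (l : List X) :
    boundary (simplex (x :: l)) = simplex l + cone x (boundary (simplex l)) := by
  rw [boundary_simplex, boundary_simplex, boundaryList]

theorem boundary_cone (x : X) (c : OrderedChain X) :
    boundary (cone x c) = c + cone x (boundary c) := by
  refine ext_simplex (f := boundary ∘ₗ cone x) (g := LinearMap.id + cone x ∘ₗ boundary)
    (fun l => ?_) c
  simp only [LinearMap.comp_apply, LinearMap.add_apply, LinearMap.id_apply]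
  rw [push_simplex, boundary_simplex_cons]

theorem boundary_simplex_mem (l : List X) :
    boundary (simplex l) ∈ supportedOn {m | m.Sublist l ∧ m.length + 1 = l.length} := by
  induction l with
  | nil => rw [boundary_simplex_nil]; exact Submodule.zero_mem _
  | cons x l ih =>
    rw [boundary_simplex_cons]
    refine Submodule.add_mem _ (simplex_mem ?_) (push_supported (fun m hm => ?_) ih)
    · exact ⟨List.sublist_cons_self x l, rfl⟩
    · exact ⟨hm.1.cons_cons x, by simpa using hm.2⟩

theorem boundary_push_map (f : X → Y) (c : OrderedChain X) :
    boundary (push (List.map f) c) = push (List.map f) (boundary c) := by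
  refine ext_simplex (f := boundary ∘ₗ push (List.map f)) (g := push (List.map f) ∘ₗ boundary)
    (fun l => ?_) c
  simp only [LinearMap.comp_apply]
  rw [push_simplex]
  induction l with
  | nil => rw [List.map_nil, boundary_simplex_nil, boundary_simplex_nil, map_zero]
  | cons x l ih =>
    rw [List.map_cons, boundary_simplex_cons, boundary_simplex_cons, map_add, push_simplex, ih]
    congr 1
    refine ext_simplex (f := cone (f x) ∘ₗ push (List.map f))
      (g := push (List.map f) ∘ₗ cone x) (fun m => ?_) _
    simp only [LinearMap.comp_apply, push_simplex, List.map_cons]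

theorem push_map_cone (f : X → Y) (x : X) (c : OrderedChain X) :
    push (List.map f) (cone x c) = cone (f x) (push (List.map f) c) := by
  refine ext_simplex (f := push (List.map f) ∘ₗ cone x)
    (g := cone (f x) ∘ₗ push (List.map f)) (fun m => ?_) _
  simp only [LinearMap.comp_apply, push_simplex, List.map_cons]

/-! ### Sorting is a chain map -/

section Sorting

variable (r : X → X → Prop) [DecidableRel r] [IsTrans X r]

/-- Modulo two the position of a new vertex does not matter, so ordered insertion obeys the boundary
formula of a cone. Sortedness of `l` ensures that if `x` goes in front of `l`, it also goes in front
of every facet of `l`. -/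
theorem boundary_orderedInsert (x : X) {l : List X} (hl : l.Pairwise r) :
    boundary (simplex (l.orderedInsert r x)) =
      simplex l + push (List.orderedInsert r x) (boundary (simplex l)) := by
  induction l with
  | nil =>
    rw [List.orderedInsert_nil, boundary_simplex_cons, boundary_simplex_nil, map_zero, map_zero]
  | cons y l ih =>
    rw [List.pairwise_cons] at hl
    by_cases hxy : r x y
    · rw [List.orderedInsert_cons_of_le r l hxy, boundary_simplex_cons]
      congr 1
      refine eqOn_supported (fun m hm => ?_) (boundary_simplex_mem (y :: l))
      rw [push_simplex, push_simplex]
      congr 1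
      cases m with
      | nil => rfl
      | cons z m =>
        have hz : z ∈ y :: l := hm.1.subset List.mem_cons_self
        have hxz : r x z := by
          rcases List.mem_cons.1 hz with rfl | hz
          · exact hxy
          · exact _root_.trans hxy (hl.1 z hz)
        rw [List.orderedInsert_cons_of_le r m hxz]
    · rw [List.orderedInsert_of_not_le r l hxy, boundary_simplex_cons, ih hl.2,
        boundary_simplex_cons, map_add, map_add, push_simplex, push_simplex]
      have : cone y (push (List.orderedInsert r x) (boundary (simplex l))) =
          push (List.orderedInsert r x) (cone y (boundary (simplex l))) := by
        refine ext_simplex (f := cone y ∘ₗ push (List.orderedInsert r x))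
          (g := push (List.orderedInsert r x) ∘ₗ cone y) (fun m => ?_) _
        simp only [LinearMap.comp_apply, push_simplex]
        rw [List.orderedInsert_of_not_le r m hxy]
      rw [this]
      abel

theorem boundary_sort [Std.Total r] (c : OrderedChain X) :
    boundary (push (List.insertionSort r) c) = push (List.insertionSort r) (boundary c) := by
  refine ext_simplex (f := boundary ∘ₗ push (List.insertionSort r))
    (g := push (List.insertionSort r) ∘ₗ boundary) (fun l => ?_) c
  simp only [LinearMap.comp_apply]
  rw [push_simplex]
  induction l with
  | nil => rw [List.insertionSort_nil, boundary_simplex_nil, map_zero]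
  | cons x l ih =>
    rw [List.insertionSort_cons, boundary_orderedInsert r x (List.pairwise_insertionSort r l), ih,
      boundary_simplex_cons, map_add, push_simplex]
    congr 1
    refine ext_simplex (f := push (List.orderedInsert r x) ∘ₗ push (List.insertionSort r))
      (g := push (List.insertionSort r) ∘ₗ cone x) (fun m => ?_) _
    simp only [LinearMap.comp_apply, push_simplex, List.insertionSort_cons]

end Sorting

/-! ### Counting sign changes -/

section Signs

variable (s : X → ZMod 2)

/-- `1` if the signs alternate along the simplex and `0` otherwise. -/
def alternates : List X → ZMod 2
  | [] => 1
  | [_] => 1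
  | x :: y :: l => (s x + s y) * alternates (y :: l)

/-- `1` if the signs alternate along the simplex, starting with `1`, and `0` otherwise. -/
def alternatesFromOne : List X → ZMod 2
  | [] => 1
  | x :: l => s x * alternates s (x :: l)

/-- The induction leaves `(s x + s z) + (s x + s y)` as the coefficient of `alternates s (z :: l)`;
the terms `s x` cancel modulo two. -/
theorem extend_alternates_cone_boundary (x y : X) (l : List X) :
    extend (alternates s) (cone x (boundary (simplex (y :: l)))) = alternates s (y :: l) := by
  induction l generalizing x y with
  | nil =>
    rw [boundary_simplex_cons, boundary_simplex_nil, map_zero, add_zero, push_simplex,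
      extend_simplex]
    rfl
  | cons z l ih =>
    have h : ∀ c : OrderedChain X, extend (alternates s) (cone x (cone y c)) =
        (s x + s y) * extend (alternates s) (cone y c) := by
      intro c
      refine ext_simplex (f := extend (alternates s) ∘ₗ cone x ∘ₗ cone y)
        (g := LinearMap.mulLeft (ZMod 2) (s x + s y) ∘ₗ extend (alternates s) ∘ₗ cone y)
        (fun m => ?_) c
      simp only [LinearMap.comp_apply, push_simplex, extend_simplex, LinearMap.mulLeft_apply]
      rfl
    rw [boundary_simplex_cons, map_add, map_add, h, ih, push_simplex, extend_simplex]
    simp only [alternates]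
    have := CharTwo.add_self_eq_zero (s x)
    linear_combination (alternates s (z :: l)) * this

/-- The door count of Tucker's lemma: an alternating simplex has exactly one facet that alternates
starting with `1`, obtained by deleting its first or last vertex, and any other simplex has an even
number of such facets. -/
theorem extend_alternatesFromOne_boundary (x : X) (l : List X) :
    extend (alternatesFromOne s) (boundary (simplex (x :: l))) = alternates s (x :: l) := by
  have h : ∀ c : OrderedChain X, extend (alternatesFromOne s) (cone x c) =
      s x * extend (alternates s) (cone x c) := by
    intro c
    refine ext_simplex (f := extend (alternatesFromOne s) ∘ₗ cone x)
      (g := LinearMap.mulLeft (ZMod 2) (s x) ∘ₗ extend (alternates s) ∘ₗ cone x)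
      (fun m => ?_) c
    simp only [LinearMap.comp_apply, push_simplex, extend_simplex, LinearMap.mulLeft_apply]
    rfl
  rw [boundary_simplex_cons, map_add, h, extend_simplex]
  cases l with
  | nil => rw [boundary_simplex_nil, map_zero, map_zero]; simp [alternatesFromOne, alternates]
  | cons y l =>
    rw [extend_alternates_cone_boundary]
    simp only [alternatesFromOne, alternates]
    ring

theorem alternates_map {ν : X → X} {l : List X} (h : ∀ x ∈ l, s (ν x) = s x + 1) :
    alternates s (l.map ν) = alternates s l := by
  induction l with
  | nil => rfl
  | cons x l ih =>
    cases l with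
    | nil => rfl
    | cons y l =>
      have ih' := ih fun z hz => h z (List.mem_cons_of_mem _ hz)
      simp only [List.map_cons, alternates] at ih' ⊢
      rw [ih', h x (by simp), h y (by simp)]
      have : (1 : ZMod 2) + 1 = 0 := CharTwo.add_self_eq_zero _
      linear_combination (alternates s (y :: l)) * this

/-- Of an alternating simplex and its antipode, exactly one starts with sign `1`. -/
theorem alternatesFromOne_map {ν : X → X} {l : List X} (hl : l ≠ [])
    (h : ∀ x ∈ l, s (ν x) = s x + 1) :
    alternatesFromOne s l + alternatesFromOne s (l.map ν) = alternates s l := by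
  obtain ⟨x, l, rfl⟩ := List.exists_cons_of_ne_nil hl
  have h1 := alternates_map s h
  rw [List.map_cons] at h1 ⊢
  simp only [alternatesFromOne]
  rw [h1, h x (by simp)]
  have := CharTwo.add_self_eq_zero (s x)
  linear_combination (alternates s (x :: l)) * this

theorem isChain_of_alternates_ne_zero {l : List X} (h : alternates s l ≠ 0) :
    l.IsChain fun x y => s x ≠ s y := by
  induction l with
  | nil => exact List.IsChain.nil
  | cons x l ih =>
    cases l with
    | nil => exact List.IsChain.singleton x
    | cons y l =>
      simp only [alternates] at h
      refine List.IsChain.cons_cons (fun hxy => ?_) (ih (right_ne_zero_of_mul h))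
      apply left_ne_zero_of_mul h
      rw [hxy]
      exact CharTwo.add_self_eq_zero _

end Signs

/-- A combinatorial Borsuk–Ulam theorem, in the spirit of Tucker's lemma. The chains `H k` play the
role of hemispheres, `ν` that of the antipodal map, and the pair `(idx, s)` that of a signed
labelling. -/
theorem no_complementary_free_labelling {n : ℕ} (ν : X → X) (idx : X → Fin n) (s : X → ZMod 2)
    (K : Set X) (hidx : ∀ x, idx (ν x) = idx x) (hs : ∀ x ∈ K, s (ν x) = s x + 1)
    (H : ℕ → OrderedChain X)
    (hmem : ∀ k ≤ n, H k ∈ supportedOn {l | l.length = k + 1 ∧ ∀ x ∈ l, x ∈ K})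
    (hzero : boundary (H 0) = simplex [])
    (hsucc : ∀ k < n, boundary (H (k + 1)) = H k + push (List.map ν) (H k))
    (hsmall : H n ∈ supportedOn {l | ∀ x ∈ l, ∀ y ∈ l, idx x = idx y → s x = s y}) : False := by
  classical
  -- Simplices are sorted by label index, with ties allowed. The invariant is the parity of the
  -- number of alternating sorted simplices in `H k`: it equals `1` for every `k`, but `0` for `k =
  -- n`.
  let r : X → X → Prop := fun x y => idx x ≤ idx y
  have : Std.Total r := ⟨fun x y => le_total (idx x) (idx y)⟩
  have : IsTrans X r := ⟨fun x y z => le_trans (a := idx x) (b := idx y) (c := idx z)⟩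
  have hdoor : ∀ k ≤ n, extend (alternates s) (push (List.insertionSort r) (H k)) =
      extend (alternatesFromOne s) (push (List.insertionSort r) (boundary (H k))) := by
    intro k hk
    rw [← boundary_sort]
    refine eqOn_supported (f := extend (alternates s) ∘ₗ push (List.insertionSort r))
      (g := extend (alternatesFromOne s) ∘ₗ boundary ∘ₗ push (List.insertionSort r))
      (fun l hl => ?_) (hmem k hk)
    simp only [LinearMap.comp_apply, push_simplex, extend_simplex]
    have hne : List.insertionSort r l ≠ [] := by
      rw [← List.length_pos_iff, List.length_insertionSort, hl.1]
      omega
    obtain ⟨x, m, hm⟩ := List.exists_cons_of_ne_nil hne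
    rw [hm, extend_alternatesFromOne_boundary]
  have hone : ∀ k ≤ n, extend (alternates s) (push (List.insertionSort r) (H k)) = 1 := by
    intro k
    induction k with
    | zero =>
      intro h0
      rw [hdoor 0 h0, hzero, push_simplex, extend_simplex]
      rfl
    | succ k ih =>
      intro hk
      rw [hdoor _ hk, hsucc k hk, ← ih (by omega), map_add, map_add]
      refine eqOn_supported
        (f := extend (alternatesFromOne s) ∘ₗ push (List.insertionSort r) +
          extend (alternatesFromOne s) ∘ₗ push (List.insertionSort r) ∘ₗ push (List.map ν))
        (g := extend (alternates s) ∘ₗ push (List.insertionSort r))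
        (fun l hl => ?_) (hmem k (by omega))
      simp only [LinearMap.comp_apply, LinearMap.add_apply, push_simplex, extend_simplex]
      -- The antipodal map preserves indices, hence commutes with sorting.
      rw [← List.map_insertionSort r r ν l fun a _ b _ => by simp only [r, hidx]]
      refine alternatesFromOne_map s ?_ fun x hx => hs x (hl.2 x ?_)
      · rw [← List.length_pos_iff, List.length_insertionSort, hl.1]
        omega
      · exact (List.mem_insertionSort r).1 hx
  have hnull : extend (alternates s) (push (List.insertionSort r) (H n)) = 0 := by
    have hboth : H n ∈ supportedOn ({l | l.length = n + 1 ∧ ∀ x ∈ l, x ∈ K} ∩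
        {l | ∀ x ∈ l, ∀ y ∈ l, idx x = idx y → s x = s y}) := by
      rw [supportedOn, Finsupp.supported_inter]
      exact ⟨hmem n le_rfl, hsmall⟩
    refine eqOn_supported (f := extend (alternates s) ∘ₗ push (List.insertionSort r)) (g := 0)
      (fun l hl => ?_) hboth
    simp only [LinearMap.comp_apply, push_simplex, extend_simplex, LinearMap.zero_apply]
    by_contra hne
    have h1 := isChain_of_alternates_ne_zero s hne
    have h2 : (List.insertionSort r l).IsChain r := (List.pairwise_insertionSort r l).isChain
    -- Neighbours have different signs, so by smallness different indices. An alternating simplex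
    -- would thus have `n + 1` strictly increasing indices in `Fin n`.
    have h3 : (List.insertionSort r l).IsChain fun x y => idx x < idx y := by
      rw [List.isChain_iff_getElem] at h1 h2 ⊢
      intro i hi
      refine lt_of_le_of_ne (h2 i hi) fun he => h1 i hi (hl.2 _ ?_ _ ?_ he)
      · exact (List.mem_insertionSort r).1 (List.getElem_mem _)
      · exact (List.mem_insertionSort r).1 (List.getElem_mem _)
    have h4 : ((List.insertionSort r l).map idx).IsChain (· < ·) := by
      rw [List.isChain_map]; exact h3
    have h5 : ((List.insertionSort r l).map idx).Nodup :=
      (List.isChain_iff_pairwise.1 h4).imp fun h => h.ne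
    have h6 := h5.length_le_card
    rw [List.length_map, List.length_insertionSort, hl.1.1, Fintype.card_fin] at h6
    omega
  rw [hone n le_rfl] at hnull
  exact one_ne_zero hnull

end OrderedChain

/-! ### Barycentric subdivision -/

namespace OrderedChain

theorem boundary_boundary {X : Type*} (c : OrderedChain X) : boundary (boundary c) = 0 := by
  refine ext_simplex (f := boundary ∘ₗ boundary) (g := 0) (fun l => ?_) c
  simp only [LinearMap.comp_apply, LinearMap.zero_apply]
  induction l with
  | nil => rw [boundary_simplex_nil, map_zero]
  | cons x l ih =>
    rw [boundary_simplex_cons, map_add, boundary_cone, ih, map_zero, add_zero, add_self]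

variable {E : Type*} [NormedAddCommGroup E] [NormedSpace ℝ E]

/-- The barycenter of a finite sequence of points. -/
noncomputable def barycenter (l : List E) : E := (l.length : ℝ)⁻¹ • l.sum

/-- The barycentric subdivision of ordered simplices with `n` vertices. -/
noncomputable def subdivide : ℕ → OrderedChain E →ₗ[ZMod 2] OrderedChain E
  | 0 => LinearMap.id
  | n + 1 => extend fun l => cone (barycenter l) (subdivide n (boundary (simplex l)))

theorem subdivide_zero : subdivide (E := E) 0 = LinearMap.id := by
  rw [subdivide]

theorem subdivide_succ_simplex (n : ℕ) (l : List E) :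
    subdivide (n + 1) (simplex l) =
      cone (barycenter l) (subdivide n (boundary (simplex l))) := by
  rw [subdivide, extend_simplex]

attribute [irreducible] subdivide

theorem boundary_mem_of_length {X : Type*} {n : ℕ} {c : OrderedChain X}
    (hc : c ∈ supportedOn {l | l.length = n + 1}) :
    boundary c ∈ supportedOn {l | l.length = n} := by
  refine map_supported (fun l hl => ?_) hc
  refine Finsupp.supported_mono (fun m hm => ?_) (boundary_simplex_mem l)
  have h1 : m.length + 1 = l.length := hm.2
  have h2 : l.length = n + 1 := hl
  show m.length = n
  omega

/-- With `S` the subdivision and `b` the barycenter, `∂(b * S∂l) = S∂l + b * ∂S∂l`, and the last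
term vanishes because `∂S∂l = S∂∂l = 0` by induction. The base case is separate because a one-vertex
simplex has the empty simplex as boundary. -/
theorem boundary_subdivide {n : ℕ} {c : OrderedChain E}
    (hc : c ∈ supportedOn {l | l.length = n + 1}) :
    boundary (subdivide (n + 1) c) = subdivide n (boundary c) := by
  induction n generalizing c with
  | zero =>
    refine eqOn_supported (f := boundary ∘ₗ subdivide (0 + 1)) (g := subdivide 0 ∘ₗ boundary)
      (fun l _ => ?_) hc
    simp only [LinearMap.comp_apply]
    rw [subdivide_succ_simplex, boundary_cone]
    simp only [subdivide_zero, LinearMap.id_apply]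
    rw [boundary_boundary, map_zero, add_zero]
  | succ n ih =>
    suffices h : (boundary ∘ₗ subdivide (n + 1 + 1)) c = (subdivide (n + 1) ∘ₗ boundary) c by
      simpa only [LinearMap.comp_apply] using h
    refine eqOn_supported (fun l hl => ?_) hc
    simp only [LinearMap.comp_apply]
    rw [subdivide_succ_simplex, boundary_cone, ih (boundary_mem_of_length (simplex_mem hl)),
      boundary_boundary, map_zero, map_zero, add_zero]

theorem barycenter_map_neg (l : List E) : barycenter (l.map Neg.neg) = -barycenter l := by
  have : (l.map Neg.neg).sum = -l.sum := by
    induction l with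
    | nil => simp
    | cons x l ih => rw [List.map_cons, List.sum_cons, List.sum_cons, ih, neg_add]
  rw [barycenter, barycenter, this, List.length_map, smul_neg]

theorem subdivide_push_neg (n : ℕ) (c : OrderedChain E) :
    subdivide n (push (List.map Neg.neg) c) = push (List.map Neg.neg) (subdivide n c) := by
  induction n generalizing c with
  | zero => simp only [subdivide_zero, LinearMap.id_apply]
  | succ n ih =>
    refine ext_simplex (f := subdivide (n + 1) ∘ₗ push (List.map Neg.neg))
      (g := push (List.map Neg.neg) ∘ₗ subdivide (n + 1)) (fun l => ?_) c
    simp only [LinearMap.comp_apply]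
    rw [push_simplex, subdivide_succ_simplex, subdivide_succ_simplex, push_map_cone, ← ih,
      ← boundary_push_map, push_simplex, barycenter_map_neg]

theorem barycenter_mem_convexHull {l : List E} (hl : l ≠ []) :
    barycenter l ∈ convexHull ℝ {x | x ∈ l} := by
  have hpos : 0 < (l.length : ℝ) := by exact_mod_cast List.length_pos_iff.2 hl
  rw [barycenter, ← Fin.sum_univ_getElem, Finset.smul_sum]
  refine (convex_convexHull ℝ _).sum_mem (fun i _ => by positivity) ?_ fun i _ =>
    subset_convexHull ℝ _ (List.getElem_mem i.2)
  rw [Finset.sum_const, Finset.card_univ, Fintype.card_fin, nsmul_eq_mul]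
  exact mul_inv_cancel₀ hpos.ne'

/-- The vertex `v` contributes nothing to the average of the differences `x - v`, so a sequence with
`M + 1` terms gives the factor `M / (M + 1)`, which increases with `M`. The fixed `N` makes one
contraction factor serve all dimensions up to `N`. -/
theorem dist_barycenter_le {N : ℕ} {l : List E} (hN : l.length ≤ N + 1) {δ : ℝ} {v : E}
    (hv : v ∈ l) (hδ : ∀ x ∈ l, dist x v ≤ δ) :
    dist (barycenter l) v ≤ N / (N + 1) * δ := by
  classical
  have h0 : 0 ≤ δ := by simpa using hδ v hv
  have key : ∀ m : List E, (∀ x ∈ m, dist x v ≤ δ) →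
      ‖m.sum - (m.length : ℝ) • v‖ ≤ m.length * δ := by
    intro m
    induction m with
    | nil => simp
    | cons x m ih =>
      intro hm
      have h1 := ih fun y hy => hm y (List.mem_cons_of_mem _ hy)
      have h2 := hm x List.mem_cons_self
      rw [dist_eq_norm] at h2
      have h3 : (x :: m).sum - ((x :: m).length : ℝ) • v =
          (x - v) + (m.sum - (m.length : ℝ) • v) := by
        rw [List.sum_cons, List.length_cons]
        push_cast
        rw [add_smul, one_smul]
        abel
      rw [h3, List.length_cons]
      push_cast
      linarith [norm_add_le (x - v) (m.sum - (m.length : ℝ) • v)]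
  have hp := List.perm_cons_erase hv
  have hlen : l.length = (l.erase v).length + 1 := by rw [hp.length_eq, List.length_cons]
  have hsum : l.sum = v + (l.erase v).sum := by rw [hp.sum_eq, List.sum_cons]
  have hk := key (l.erase v) fun x hx => hδ x (List.mem_of_mem_erase hx)
  set M := (l.erase v).length
  have hM : (0 : ℝ) < (M : ℝ) + 1 := by positivity
  have hMN : (M : ℝ) ≤ N := by
    have : M ≤ N := by omega
    exact_mod_cast this
  have heq : barycenter l - v = ((M : ℝ) + 1)⁻¹ • ((l.erase v).sum - (M : ℝ) • v) := by
    rw [barycenter, hlen, hsum]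
    push_cast
    rw [eq_inv_smul_iff₀ hM.ne', smul_sub, smul_inv_smul₀ hM.ne', add_smul, one_smul]
    abel
  rw [dist_eq_norm, heq, norm_smul, norm_inv, Real.norm_of_nonneg hM.le]
  calc ((M : ℝ) + 1)⁻¹ * ‖(l.erase v).sum - (M : ℝ) • v‖ ≤ ((M : ℝ) + 1)⁻¹ * (M * δ) := by gcongr
    _ = M / (M + 1) * δ := by ring
    _ ≤ N / (N + 1) * δ := by
      refine mul_le_mul_of_nonneg_right ?_ h0
      rw [div_le_div_iff₀ hM (by positivity)]
      linarith

/-- Ordered affine simplices with `n` vertices, contained in `A` and of diameter at most `δ`. -/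
def smallSimplices (n : ℕ) (A : Set E) (δ : ℝ) : Set (List E) :=
  {l | l.length = n ∧ convexHull ℝ {x | x ∈ l} ⊆ A ∧ ∀ x ∈ l, ∀ y ∈ l, dist x y ≤ δ}

theorem subdivide_simplex_mem {N n : ℕ} (hn : n ≤ N + 1) {δ : ℝ} {l : List E}
    (hl : l.length = n) (hδ : ∀ x ∈ l, ∀ y ∈ l, dist x y ≤ δ) :
    subdivide n (simplex l) ∈
      supportedOn (smallSimplices n (convexHull ℝ {x | x ∈ l}) (N / (N + 1) * δ)) := by
  induction n generalizing l with
  | zero =>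
    rw [List.length_eq_zero_iff] at hl
    subst hl
    rw [subdivide_zero]
    exact simplex_mem ⟨rfl, subset_rfl, by simp⟩
  | succ n ih =>
    have hne : l ≠ [] := by
      rw [← List.length_pos_iff]
      omega
    rw [subdivide_succ_simplex]
    have hb : subdivide n (boundary (simplex l)) ∈ supportedOn
        (smallSimplices n (convexHull ℝ {x | x ∈ l}) (N / (N + 1) * δ)) := by
      refine map_supported (fun m hm => ?_) (boundary_simplex_mem l)
      have hsub : ∀ x ∈ m, x ∈ l := fun x hx => hm.1.subset hx
      have hlen : m.length + 1 = l.length := hm.2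
      refine Finsupp.supported_mono (fun q hq => ?_)
        (ih (l := m) (by omega) (by omega) fun x hx y hy => hδ x (hsub x hx) y (hsub y hy))
      exact ⟨hq.1, hq.2.1.trans (convexHull_mono hsub), hq.2.2⟩
    refine push_supported (fun m hm => ?_) hb
    have hm' : ∀ x ∈ m, x ∈ convexHull ℝ {x | x ∈ l} := fun x hx =>
      hm.2.1 (subset_convexHull ℝ _ hx)
    have hdist : ∀ x ∈ m, dist (barycenter l) x ≤ N / (N + 1) * δ := by
      intro x hx
      -- The bound at the vertices of `l` extends to the whole simplex by convexity of balls, and so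
      -- covers the new vertices created on the subdivided facets.
      have : convexHull ℝ {x | x ∈ l} ⊆ Metric.closedBall (barycenter l) (N / (N + 1) * δ) := by
        refine convexHull_min (fun v hv => ?_) (convex_closedBall _ _)
        rw [Metric.mem_closedBall']
        exact dist_barycenter_le (by omega) hv fun y hy => hδ y hy v hv
      rw [← Metric.mem_closedBall']
      exact this (hm' x hx)
    have h0 : 0 ≤ N / (N + 1) * δ := by
      obtain ⟨x, m', hx⟩ := List.exists_cons_of_ne_nil hne
      have := hδ x (by simp [hx]) x (by simp [hx])
      rw [dist_self] at this
      positivity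
    refine ⟨by rw [List.length_cons, hm.1], ?_, ?_⟩
    · refine convexHull_min (fun x hx => ?_) (convex_convexHull ℝ _)
      rcases List.mem_cons.1 hx with rfl | hx
      · exact barycenter_mem_convexHull hne
      · exact hm' x hx
    · intro x hx y hy
      rcases List.mem_cons.1 hx with rfl | hx <;> rcases List.mem_cons.1 hy with rfl | hy
      · rwa [dist_self]
      · exact hdist y hy
      · rw [dist_comm]
        exact hdist x hx
      · exact hm.2.2 x hx y hy

theorem subdivide_pow_mem {N n : ℕ} (hn : n ≤ N + 1) {A : Set E} {δ : ℝ} {c : OrderedChain E}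
    (hc : c ∈ supportedOn (smallSimplices n A δ)) (m : ℕ) :
    (subdivide n ^ m) c ∈ supportedOn (smallSimplices n A (((N : ℝ) / (N + 1)) ^ m * δ)) := by
  induction m with
  | zero => simpa using hc
  | succ m ih =>
    rw [pow_succ' (subdivide n) m, Module.End.mul_apply]
    refine map_supported (fun l hl => ?_) ih
    refine Finsupp.supported_mono (fun q hq => ?_) (subdivide_simplex_mem hn hl.1 hl.2.2)
    refine ⟨hq.1, hq.2.1.trans hl.2.1, fun x hx y hy => (hq.2.2 x hx y hy).trans_eq ?_⟩
    ring

theorem subdivide_pow_push_neg (n m : ℕ) (c : OrderedChain E) :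
    (subdivide n ^ m) (push (List.map Neg.neg) c) =
      push (List.map Neg.neg) ((subdivide n ^ m) c) := by
  induction m with
  | zero => rfl
  | succ m ih =>
    rw [pow_succ' (subdivide n) m, Module.End.mul_apply, Module.End.mul_apply, ih, subdivide_push_neg]

theorem boundary_subdivide_pow {n : ℕ} {A : Set E} {δ : ℝ} {c : OrderedChain E}
    (hc : c ∈ supportedOn (smallSimplices (n + 1) A δ)) (m : ℕ) :
    boundary ((subdivide (n + 1) ^ m) c) = (subdivide n ^ m) (boundary c) := by
  induction m with
  | zero => rfl
  | succ m ih =>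
    rw [pow_succ' (subdivide (n + 1)) m, pow_succ' (subdivide n) m, Module.End.mul_apply, Module.End.mul_apply, ← ih,
      boundary_subdivide]
    exact Finsupp.supported_mono (fun l hl => hl.1) (subdivide_pow_mem (N := n) le_rfl hc m)

/-! ### The boundary of the cross-polytope -/

/-- The fundamental cycle of the boundary of the cross-polytope with vertices
`± e 0, …, ± e (k - 1)`. -/
noncomputable def crossPolytope {E : Type*} [NormedAddCommGroup E] (e : ℕ → E) : ℕ → OrderedChain E
  | 0 => simplex []
  | k + 1 => cone (e k) (crossPolytope e k) +
      push (List.map Neg.neg) (cone (e k) (crossPolytope e k))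

theorem push_neg_push_neg {E : Type*} [NormedAddCommGroup E] (c : OrderedChain E) :
    push (List.map Neg.neg) (push (List.map Neg.neg) c) = c := by
  refine ext_simplex (f := push (List.map Neg.neg) ∘ₗ push (List.map Neg.neg))
    (g := LinearMap.id) (fun l => ?_) c
  simp only [LinearMap.comp_apply, LinearMap.id_apply]
  rw [push_simplex, push_simplex, List.map_map]
  congr 1
  simp

theorem push_neg_crossPolytope {E : Type*} [NormedAddCommGroup E] (e : ℕ → E) (k : ℕ) :
    push (List.map Neg.neg) (crossPolytope e k) = crossPolytope e k := by
  cases k with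
  | zero => rw [crossPolytope, push_simplex, List.map_nil]
  | succ k => rw [crossPolytope, map_add, push_neg_push_neg, add_comm]

theorem boundary_crossPolytope {E : Type*} [NormedAddCommGroup E] (e : ℕ → E) (k : ℕ) : boundary (crossPolytope e k) = 0 := by
  induction k with
  | zero => exact boundary_simplex_nil
  | succ k ih =>
    rw [crossPolytope, map_add, boundary_push_map, boundary_cone, ih, map_zero, add_zero,
      push_neg_crossPolytope, add_self]

/-- The cone is the upper hemisphere of dimension `k`. Its boundary is the equator, which for
positive `k` is the sum of the two hemispheres one dimension lower; this is the recursion that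
`no_complementary_free_labelling` asks of `H`. -/
theorem boundary_cone_crossPolytope {E : Type*} [NormedAddCommGroup E] (e : ℕ → E) (k : ℕ) :
    boundary (cone (e k) (crossPolytope e k)) = crossPolytope e k := by
  rw [boundary_cone, boundary_crossPolytope, map_zero, add_zero]

end OrderedChain

/-! ### The Borsuk–Ulam theorem -/

section BorsukUlam

open OrderedChain

/-- A compact symmetric shell around the origin that contains the boundary of the
cross-polytope. -/
def crossShell (n : ℕ) : Set (EuclideanSpace ℝ (Fin n)) := {x | ‖x‖ ≤ 1 ∧ 1 ≤ ∑ i, |x i|}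

theorem isCompact_crossShell (n : ℕ) : IsCompact (crossShell n) := by
  have hc : IsClosed {x : EuclideanSpace ℝ (Fin n) | 1 ≤ ∑ i, |x i|} :=
    isClosed_le continuous_const (by fun_prop)
  have heq : crossShell n =
      Metric.closedBall 0 1 ∩ {x : EuclideanSpace ℝ (Fin n) | 1 ≤ ∑ i, |x i|} := by
    apply Set.ext
    intro x
    rw [Set.mem_inter_iff, mem_closedBall_zero_iff]
    rfl
  rw [heq]
  exact (isCompact_closedBall (0 : EuclideanSpace ℝ (Fin n)) 1).inter_right hc

theorem crossShell_ne_zero {n : ℕ} {x : EuclideanSpace ℝ (Fin n)} (hx : x ∈ crossShell n) :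
    x ≠ 0 := by
  rintro rfl
  have := hx.2
  simp at this
  linarith

/-- The standard basis vectors, extended by zero. -/
noncomputable def stdVector (n k : ℕ) : EuclideanSpace ℝ (Fin n) :=
  if h : k < n then EuclideanSpace.single ⟨k, h⟩ 1 else 0

/-- Sequences of `k` points in a common facet of the cross-polytope, spanned by the first `k`
coordinate directions. -/
def facetSimplices (n k : ℕ) : Set (List (EuclideanSpace ℝ (Fin n))) :=
  {l | l.length = k ∧ ∃ τ : Fin n → ℝ, (∀ i, |τ i| ≤ 1) ∧ ∀ x ∈ l, ‖x‖ ≤ 1 ∧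
    ∑ i, τ i * x i = 1 ∧ ∀ i : Fin n, k ≤ i → x i = 0}

theorem cons_stdVector_mem_facetSimplices {n k : ℕ} (hk : k < n)
    {l : List (EuclideanSpace ℝ (Fin n))} (hl : l ∈ facetSimplices n k) :
    stdVector n k :: l ∈ facetSimplices n (k + 1) := by
  obtain ⟨hlen, τ, hτ, h⟩ := hl
  -- The old points have vanishing coordinate `k`, so resetting `τ` there to `1` keeps their
  -- equations and makes the functional equal to `1` at the new vertex.
  refine ⟨by rw [List.length_cons, hlen], Function.update τ ⟨k, hk⟩ 1, fun i => ?_, ?_⟩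
  · by_cases hi : i = ⟨k, hk⟩
    · simp [hi]
    · simpa [Function.update_of_ne hi] using hτ i
  · intro x hx
    rcases List.mem_cons.1 hx with rfl | hx
    · rw [stdVector, dif_pos hk]
      refine ⟨by simp, ?_, fun i hi => ?_⟩
      · rw [Finset.sum_eq_single ⟨k, hk⟩] <;> simp +contextual
      · have : i ≠ ⟨k, hk⟩ := by
          rintro rfl
          simp at hi
        simp [this]
    · obtain ⟨h1, h2, h3⟩ := h x hx
      refine ⟨h1, ?_, fun i hi => h3 i (by omega)⟩
      rw [← h2]
      refine Finset.sum_congr rfl fun i _ => ?_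
      by_cases hi : i = ⟨k, hk⟩
      · rw [hi, h3 _ le_rfl, mul_zero, mul_zero]
      · rw [Function.update_of_ne hi]

theorem map_neg_mem_facetSimplices {n k : ℕ} {l : List (EuclideanSpace ℝ (Fin n))}
    (hl : l ∈ facetSimplices n k) : l.map Neg.neg ∈ facetSimplices n k := by
  obtain ⟨hlen, τ, hτ, h⟩ := hl
  refine ⟨by rw [List.length_map, hlen], fun i => -τ i, fun i => by rw [abs_neg]; exact hτ i, ?_⟩
  intro x hx
  obtain ⟨y, hy, rfl⟩ := List.mem_map.1 hx
  obtain ⟨h1, h2, h3⟩ := h y hy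
  exact ⟨by rwa [norm_neg], by simpa using h2, fun i hi => by simp [h3 i hi]⟩

theorem crossPolytope_mem {n k : ℕ} (hk : k ≤ n) :
    crossPolytope (stdVector n) k ∈ supportedOn (facetSimplices n k) := by
  induction k with
  | zero => exact simplex_mem ⟨rfl, 0, by simp, by simp⟩
  | succ k ih =>
    have h := push_supported (fun l hl => cons_stdVector_mem_facetSimplices hk hl) (ih (by omega))
    exact Submodule.add_mem _ h (push_supported (fun l hl => map_neg_mem_facetSimplices hl) h)

/-- The equation `∑ i, τ i * x i = 1` passes to the convex hull and forces `1 ≤ ∑ i, |x i|`, because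
`|τ i| ≤ 1`. So the simplices stay away from the origin without being projected to the sphere. -/
theorem facetSimplices_subset (n k : ℕ) :
    facetSimplices n k ⊆ smallSimplices k (crossShell n) 2 := by
  rintro l ⟨hlen, τ, hτ, h⟩
  refine ⟨hlen, ?_, fun x hx y hy => ?_⟩
  · have hconv : Convex ℝ (Metric.closedBall (0 : EuclideanSpace ℝ (Fin n)) 1 ∩
        {x | ∑ i, τ i * x i = 1}) := by
      refine (convex_closedBall _ _).inter ?_
      refine convex_hyperplane (f := fun x : EuclideanSpace ℝ (Fin n) => ∑ i, τ i * x i) ?_ 1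
      constructor
      · intro x y
        simp [mul_add, Finset.sum_add_distrib]
      · intro c x
        simp only [PiLp.smul_apply, smul_eq_mul, Finset.mul_sum]
        exact Finset.sum_congr rfl fun i _ => by ring
    intro x hx
    obtain ⟨h1, h2⟩ := convexHull_min (fun x hx =>
      Set.mem_inter (mem_closedBall_zero_iff.2 (h x hx).1) (h x hx).2.1) hconv hx
    refine ⟨by simpa using h1, ?_⟩
    rw [← show ∑ i, τ i * x i = 1 from h2]
    refine Finset.sum_le_sum fun i _ => (le_abs_self _).trans ?_
    rw [abs_mul]
    exact mul_le_of_le_one_left (abs_nonneg _) (hτ i)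
  · rw [dist_eq_norm]
    linarith [norm_sub_le x y, (h x hx).1, (h y hy).1]

/-- The Borsuk–Ulam theorem for maps on punctured Euclidean space. -/
theorem exists_zero_of_odd {n : ℕ} (G : EuclideanSpace ℝ (Fin (n + 1)) → Fin n → ℝ)
    (hodd : Function.Odd G) (hcont : ContinuousOn G {0}ᶜ) : ∃ x ≠ 0, G x = 0 := by
  classical
  by_contra! hne
  -- If `n = 0`, every value of `G` is zero. Otherwise a coordinate of largest absolute value exists
  -- and serves as label.
  have hn : Nonempty (Fin n) := by
    by_contra hn
    rw [not_nonempty_iff] at hn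
    exact hne (EuclideanSpace.single 0 1) (by simp) (Subsingleton.elim _ _)
  have hK := isCompact_crossShell (n + 1)
  set K := crossShell (n + 1)
  have hcK : ContinuousOn G K := hcont.mono fun x hx => crossShell_ne_zero hx
  obtain ⟨η, hη, hmin⟩ := hK.exists_forall_le' hcK.norm (a := 0)
    fun x hx => norm_pos_iff.2 (hne x (crossShell_ne_zero hx))
  obtain ⟨δ, hδ, hunif⟩ := Metric.uniformContinuousOn_iff.1
    (hK.uniformContinuousOn_of_continuous hcK) η hη
  choose argmax hargmax using fun v : Fin n → ℝ => Finite.exists_max v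
  let idx : EuclideanSpace ℝ (Fin (n + 1)) → Fin n := fun x => argmax fun i => |G x i|
  have hidx : ∀ x, idx (-x) = idx x := fun x => by simp only [idx, hodd x, Pi.neg_apply, abs_neg]
  have hbig : ∀ x ∈ K, η ≤ |G x (idx x)| := fun x hx =>
    (hmin x hx).trans ((pi_norm_le_iff_of_nonneg (abs_nonneg _)).2 fun i =>
      hargmax (fun i => |G x i|) i)
  let s : EuclideanSpace ℝ (Fin (n + 1)) → ZMod 2 := fun x => if 0 < G x (idx x) then 1 else 0
  have hs : ∀ x ∈ K, s (-x) = s x + 1 := by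
    intro x hx
    have h1 := hbig x hx
    simp only [s, hidx, hodd x, Pi.neg_apply]
    rcases lt_or_ge 0 (G x (idx x)) with h | h
    · rw [if_neg (by linarith), if_pos h]
      exact (CharTwo.add_self_eq_zero _).symm
    · rw [abs_of_nonpos h] at h1
      rw [if_pos (by linarith), if_neg (by linarith), zero_add]
  -- Equal indices with opposite signs would make that coordinate differ by at least `2 * η`, while
  -- points closer than `δ` have values closer than `η`.
  have hpair : ∀ x ∈ K, ∀ y ∈ K, dist x y < δ → idx x = idx y → 0 < G x (idx x) →
      0 < G y (idx y) := by
    intro x hx y hy hxy hi hpos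
    have h1 := hbig x hx
    have h2 := hbig y hy
    have h3 := (dist_le_pi_dist (G x) (G y) (idx x)).trans_lt (hunif x hx y hy hxy)
    rw [Real.dist_eq] at h3
    rw [hi] at h1 h3 hpos
    by_contra hle
    rw [not_lt] at hle
    rw [abs_of_nonpos hle] at h2
    linarith [le_abs_self (G x (idx y) - G y (idx y))]
  -- The initial simplices have diameter at most `2`, so `m` subdivisions bring the diameter below
  -- `δ`.
  obtain ⟨m, hm⟩ := exists_pow_lt_of_lt_one (half_pos hδ)
    (show (n : ℝ) / (n + 1) < 1 by rw [div_lt_one (by positivity)]; linarith)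
  have hcone : ∀ k ≤ n, cone (stdVector (n + 1) k) (crossPolytope (stdVector (n + 1)) k) ∈
      supportedOn (smallSimplices (k + 1) K 2) := fun k hk =>
    Finsupp.supported_mono (facetSimplices_subset _ _)
      (push_supported (fun l hl => cons_stdVector_mem_facetSimplices (by omega) hl)
        (crossPolytope_mem (by omega)))
  let H : ℕ → OrderedChain (EuclideanSpace ℝ (Fin (n + 1))) := fun k =>
    (subdivide (k + 1) ^ m) (cone (stdVector (n + 1) k) (crossPolytope (stdVector (n + 1)) k))
  have hH : ∀ k ≤ n, H k ∈ supportedOn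
      (smallSimplices (k + 1) K (((n : ℝ) / (n + 1)) ^ m * 2)) := fun k hk =>
    subdivide_pow_mem (by omega) (hcone k hk) m
  refine no_complementary_free_labelling Neg.neg idx s K hidx hs H (fun k hk => ?_) ?_
    (fun k hk => ?_) ?_
  · refine Finsupp.supported_mono (fun l hl => ?_) (hH k hk)
    exact ⟨hl.1, fun x hx => hl.2.1 (subset_convexHull ℝ _ hx)⟩
  · simp only [H]
    rw [boundary_subdivide_pow (hcone 0 (by omega)), boundary_cone_crossPolytope]
    simp only [subdivide_zero, crossPolytope]
    rw [show (LinearMap.id : OrderedChain (EuclideanSpace ℝ (Fin (n + 1))) →ₗ[ZMod 2] _) = 1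
      from rfl, one_pow, Module.End.one_apply]
  · simp only [H]
    rw [boundary_subdivide_pow (hcone (k + 1) hk), boundary_cone_crossPolytope, crossPolytope,
      map_add, subdivide_pow_push_neg]
  · refine Finsupp.supported_mono (fun l hl x hx y hy hi => ?_) (hH n le_rfl)
    have hxK := hl.2.1 (subset_convexHull ℝ _ hx)
    have hyK := hl.2.1 (subset_convexHull ℝ _ hy)
    have hxy : dist x y < δ := (hl.2.2 x hx y hy).trans_lt (by linarith)
    have h1 := hpair x hxK y hyK hxy hi
    have h2 := hpair y hyK x hxK (by rwa [dist_comm]) hi.symm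
    simp only [s]
    exact if_congr ⟨h1, h2⟩ rfl rfl

/-- The radial projection of a nonzero vector to the unit sphere. -/
noncomputable def UnitSphere.ofNeZero {n : ℕ} (x : EuclideanSpace ℝ (Fin n)) (hx : x ≠ 0) :
    UnitSphere n :=
  ⟨‖x‖⁻¹ • x, by
    rw [mem_sphere_zero_iff_norm, norm_smul, norm_inv, norm_norm,
      inv_mul_cancel₀ (norm_ne_zero_iff.2 hx)]⟩

theorem UnitSphere.ofNeZero_neg {n : ℕ} (x : EuclideanSpace ℝ (Fin n)) (hx : x ≠ 0)
    (hx' : -x ≠ 0) : UnitSphere.ofNeZero (-x) hx' = -UnitSphere.ofNeZero x hx := by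
  apply Subtype.ext
  simp [UnitSphere.ofNeZero]

theorem UnitSphere.continuous_ofNeZero {n : ℕ} {X : Type*} [TopologicalSpace X]
    {f : X → EuclideanSpace ℝ (Fin n)} (hf : Continuous f) (h : ∀ x, f x ≠ 0) :
    Continuous fun x => UnitSphere.ofNeZero (f x) (h x) :=
  Continuous.subtype_mk ((hf.norm.inv₀ fun x => norm_ne_zero_iff.2 (h x)).smul hf) _

/-- The Borsuk–Ulam theorem. -/
theorem UnitSphere.exists_zero_of_odd {n : ℕ} {g : UnitSphere (n + 1) → Fin n → ℝ}
    (hcont : Continuous g) (hodd : Function.Odd g) : ∃ x, g x = 0 := by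
  classical
  -- The extension is constant along rays. The value `0` at the origin makes it odd everywhere;
  -- continuity is needed only off the origin.
  let G : EuclideanSpace ℝ (Fin (n + 1)) → Fin n → ℝ := fun x =>
    if hx : x ≠ 0 then g (UnitSphere.ofNeZero x hx) else 0
  have hGodd : Function.Odd G := by
    intro x
    by_cases hx : x = 0
    · simp [G, hx]
    · have hx' : -x ≠ 0 := neg_ne_zero.2 hx
      simp only [G]
      rw [dif_pos hx, dif_pos hx', ← hodd, UnitSphere.ofNeZero_neg x hx]
  have hGcont : ContinuousOn G {0}ᶜ := by
    rw [continuousOn_iff_continuous_domRestrict]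
    have hne : ∀ x : ({0}ᶜ : Set (EuclideanSpace ℝ (Fin (n + 1)))), x.1 ≠ 0 := fun x =>
      Set.mem_compl_singleton_iff.1 x.2
    have heq : ({0}ᶜ : Set (EuclideanSpace ℝ (Fin (n + 1)))).domRestrict G =
        fun x => g (UnitSphere.ofNeZero x.1 (hne x)) := by
      funext x
      simp only [Set.domRestrict_apply, G, dif_pos (hne x)]
    rw [heq]
    exact hcont.comp (UnitSphere.continuous_ofNeZero continuous_subtype_val hne)
  obtain ⟨x, hx, h⟩ := _root_.exists_zero_of_odd G hGodd hGcont
  simp only [G, dif_pos hx] at h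
  exact ⟨_, h⟩

end BorsukUlam

/-! ### Alternating sequences and moments -/

section Moments

open Polynomial

theorem mul_neg_of_mul_pos_of_mul_neg {a b c p : ℝ} (h₁ : 0 < b * p) (h₂ : b * a < 0)
    (h₃ : 0 < c * a) : c * p < 0 := by
  by_contra! h
  nlinarith [mul_pos h₁ h₃, mul_nonneg h (neg_pos.2 h₂).le]

theorem mul_neg_of_three_mul_neg {a b c e : ℝ} (h₁ : a * b < 0) (h₂ : b * c < 0)
    (h₃ : c * e < 0) : a * e < 0 := by
  by_contra! h
  nlinarith [mul_pos_of_neg_of_neg h₁ h₃, mul_nonneg h (neg_pos.2 h₂).le]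

/-- A finite set of signed reals either contains a long alternating sequence or is separated
according to signs by a polynomial of small degree. -/
theorem exists_alternating_or_polynomial (σ : ℝ → ℝ) (d : ℕ) (S : Finset ℝ)
    (hσ : ∀ t ∈ S, σ t ≠ 0) (a : ℝ) (haS : a ∈ S) (ha : ∀ t ∈ S, t ≤ a) :
    (∃ c : ℕ → ℝ, (∀ i ≤ d + 1, c i ∈ S) ∧
      ∀ i ≤ d, c (i + 1) < c i ∧ σ (c i) * σ (c (i + 1)) < 0) ∨
    ∃ p : ℝ[X], p.natDegree ≤ d ∧ (∀ t ∈ S, 0 < σ t * p.eval t) ∧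
      ∀ t, a ≤ t → 0 < σ a * p.eval t := by
  classical
  -- The sign condition to the right of the maximum `a` is what the induction needs: it controls the
  -- old polynomial at points that are added above.
  induction d generalizing S a with
  | zero =>
    by_cases hT : ∃ b ∈ S, σ b * σ a < 0
    · obtain ⟨b, hbS, hb⟩ := hT
      refine Or.inl ⟨fun i => if i = 0 then a else b, fun i _ => ?_, fun i hi => ?_⟩
      · dsimp only
        split_ifs <;> assumption
      · obtain rfl : i = 0 := by omega
        have hne : b ≠ a := by
          rintro rfl
          exact hb.not_ge (mul_self_nonneg _)
        simpa [mul_comm] using And.intro (lt_of_le_of_ne (ha b hbS) hne) hb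
    · push Not at hT
      refine Or.inr ⟨C (σ a), by simp, fun t ht => ?_, fun t _ => ?_⟩
      · rw [eval_C]
        exact lt_of_le_of_ne (hT t ht) (mul_ne_zero (hσ t ht) (hσ a haS)).symm
      · rw [eval_C]
        exact lt_of_le_of_ne (hT a haS) (mul_ne_zero (hσ a haS) (hσ a haS)).symm
  | succ d ih =>
    by_cases hT : (S.filter fun t => σ t * σ a < 0).Nonempty
    · obtain ⟨b, hb, hbmax⟩ := Finset.exists_max_image _ id hT
      rw [Finset.mem_filter] at hb
      obtain ⟨hbS, hba⟩ := hb
      have hlt : b < a := by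
        refine lt_of_le_of_ne (ha b hbS) ?_
        rintro rfl
        exact hba.not_ge (mul_self_nonneg _)
      have habove : ∀ t ∈ S, b < t → 0 < σ t * σ a := fun t ht hbt => by
        refine lt_of_le_of_ne ?_ (mul_ne_zero (hσ t ht) (hσ a haS)).symm
        by_contra! h
        exact hbt.not_ge (hbmax t (Finset.mem_filter.2 ⟨ht, h⟩))
      rcases ih (S.filter fun t => t ≤ b) (fun t ht => hσ t (Finset.mem_filter.1 ht).1) b
        (Finset.mem_filter.2 ⟨hbS, le_rfl⟩) (fun t ht => (Finset.mem_filter.1 ht).2) with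
        ⟨c, hcS, hc⟩ | ⟨p, hdeg, hpS, hpb⟩
      · left
        have hc0 := Finset.mem_filter.1 (hcS 0 (by omega))
        have hext : ∀ u ∈ S, c 0 < u → σ u * σ (c 0) < 0 → ∃ c : ℕ → ℝ,
            (∀ i ≤ d + 1 + 1, c i ∈ S) ∧
              ∀ i ≤ d + 1, c (i + 1) < c i ∧ σ (c i) * σ (c (i + 1)) < 0 := by
          intro u hu hlt' hneg
          refine ⟨fun i => Nat.casesOn i u c, fun i hi => ?_, fun i hi => ?_⟩
          · cases i with
            | zero => exact hu
            | succ i => exact (Finset.mem_filter.1 (hcS i (by omega))).1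
          · cases i with
            | zero => exact ⟨hlt', hneg⟩
            | succ i => exact hc i (by omega)
        -- The sequence is extended by `a` if `c 0` has the sign of `b`, and by `b` itself if `c 0`
        -- has the sign of `a`.
        by_cases hsign : σ (c 0) * σ a < 0
        · exact hext a haS (hc0.2.trans_lt hlt) (by rwa [mul_comm])
        · have hpos : 0 < σ (c 0) * σ a := lt_of_le_of_ne (not_lt.1 hsign)
            (mul_ne_zero (hσ _ hc0.1) (hσ a haS)).symm
          have hne : c 0 ≠ b := fun h => hsign (h ▸ hba)
          refine hext b hbS (lt_of_le_of_ne hc0.2 hne) ?_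
          have := mul_neg_of_mul_pos_of_mul_neg (a := σ b) (b := σ a) (c := σ b) (p := σ (c 0))
            (by rwa [mul_comm]) (by rwa [mul_comm]) (mul_self_pos.2 (hσ b hbS))
          exact this
      · right
        -- A linear factor with root midway between `b` and the next point `u` of `S` supplies the
        -- one missing sign change.
        have hU : (S.filter fun t => b < t).Nonempty := ⟨a, Finset.mem_filter.2 ⟨haS, hlt⟩⟩
        obtain ⟨u, hu, humin⟩ := Finset.exists_min_image _ id hU
        have hbu : b < u := (Finset.mem_filter.1 hu).2
        have hua : u ≤ a := ha u (Finset.mem_filter.1 hu).1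
        have hneg : ∀ s t, 0 < σ s * σ a → u ≤ t →
            0 < σ s * (p * (C ((b + u) / 2) - X)).eval t := by
          intro s t hs ht
          have h := mul_neg_of_mul_pos_of_mul_neg (hpb t (by linarith)) hba hs
          rw [eval_mul, eval_sub, eval_C, eval_X, ← mul_assoc]
          exact mul_pos_of_neg_of_neg h (by linarith)
        refine ⟨p * (C ((b + u) / 2) - X), ?_, fun t ht => ?_, fun t ht => ?_⟩
        · refine natDegree_mul_le.trans (add_le_add hdeg ?_)
          refine (natDegree_sub_le _ _).trans ?_
          simp
        · rcases le_or_gt t b with htb | htb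
          · rw [eval_mul, eval_sub, eval_C, eval_X, ← mul_assoc]
            exact mul_pos (hpS t (Finset.mem_filter.2 ⟨ht, htb⟩)) (by linarith)
          · exact hneg t t (habove t ht htb) (humin t (Finset.mem_filter.2 ⟨ht, htb⟩))
        · exact hneg a t (mul_self_pos.2 (hσ a haS)) (hua.trans ht)
    · rw [Finset.not_nonempty_iff_eq_empty, Finset.filter_eq_empty_iff] at hT
      refine Or.inr ⟨C (σ a), by simp, fun t ht => ?_, fun t _ => ?_⟩
      · rw [eval_C]
        exact lt_of_le_of_ne (not_lt.1 (hT ht)) (mul_ne_zero (hσ t ht) (hσ a haS)).symm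
      · rw [eval_C]
        exact mul_self_pos.2 (hσ a haS)

/-- If the first `d + 1` moments of a nonzero signed measure with finite support vanish, then the
signs of the measure change at least `d + 1` times. -/
theorem exists_alternating_of_moments_eq_zero {V : Type*} [Fintype V] (t y : V → ℝ) (d : ℕ)
    (hy : ∃ v, y v ≠ 0) (hsep : ∀ v w, y v * y w < 0 → t v ≠ t w)
    (hmom : ∀ j : Fin (d + 1), ∑ v, y v * t v ^ (j : ℕ) = 0) :
    ∃ c : ℕ → V, ∀ i ≤ d, t (c (i + 1)) < t (c i) ∧ y (c i) * y (c (i + 1)) < 0 := by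
  classical
  obtain ⟨v₀, hv₀⟩ := hy
  let S : Finset ℝ := (Finset.univ.filter fun v => y v ≠ 0).image t
  have hmemS : ∀ v, y v ≠ 0 → t v ∈ S := fun v hv =>
    Finset.mem_image_of_mem t (Finset.mem_filter.2 ⟨Finset.mem_univ v, hv⟩)
  -- Several vertices may share a position; by `hsep` their weights never have opposite signs, so
  -- one representative fixes the sign there. Off `S` the value `v₀` is a dummy.
  have hrep : ∀ x : ℝ, ∃ v, x ∈ S → y v ≠ 0 ∧ t v = x := by
    intro x
    by_cases hx : x ∈ S
    · obtain ⟨v, hv, hvx⟩ := Finset.mem_image.1 hx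
      exact ⟨v, fun _ => ⟨(Finset.mem_filter.1 hv).2, hvx⟩⟩
    · exact ⟨v₀, fun h => absurd h hx⟩
  choose rep hrep using hrep
  have hSne : S.Nonempty := ⟨t v₀, hmemS v₀ hv₀⟩
  rcases exists_alternating_or_polynomial (fun x => y (rep x)) d S (fun x hx => (hrep x hx).1)
    (S.max' hSne) (S.max'_mem hSne) (fun x hx => S.le_max' x hx) with ⟨c, hcS, hc⟩ | ⟨p, hdeg, hp, -⟩
  · refine ⟨fun i => rep (c i), fun i hi => ⟨?_, (hc i hi).2⟩⟩
    rw [(hrep _ (hcS (i + 1) (by omega))).2, (hrep _ (hcS i (by omega))).2]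
    exact (hc i hi).1
  · exfalso
    have hpos : ∀ v, y v ≠ 0 → 0 < y v * p.eval (t v) := by
      intro v hv
      have h1 := hp (t v) (hmemS v hv)
      have h2 := hrep (t v) (hmemS v hv)
      have h3 : 0 ≤ y (rep (t v)) * y v := by
        by_contra! h
        exact hsep _ _ h h2.2
      have h4 : 0 < y (rep (t v)) * y v := lt_of_le_of_ne h3 (mul_ne_zero h2.1 hv).symm
      have h5 := mul_pos h1 h4
      have h6 : y (rep (t v)) * p.eval (t v) * (y (rep (t v)) * y v) =
          y (rep (t v)) ^ 2 * (y v * p.eval (t v)) := by ring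
      rw [h6] at h5
      exact pos_of_mul_pos_right h5 (sq_nonneg _)
    -- The sum is a combination of the vanishing moments, yet it has nonnegative terms and a
    -- positive term at `v₀`.
    have hsum : ∑ v, y v * p.eval (t v) = 0 := by
      have h1 : ∀ v, y v * p.eval (t v) =
          ∑ j : Fin (d + 1), p.coeff j * (y v * t v ^ (j : ℕ)) := by
        intro v
        rw [eval_eq_sum_range' (Nat.lt_succ_of_le hdeg), Finset.mul_sum, ← Fin.sum_univ_eq_sum_range
          (fun j => y v * (p.coeff j * t v ^ j))]
        exact Finset.sum_congr rfl fun j _ => by ring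
      rw [Finset.sum_congr rfl fun v _ => h1 v, Finset.sum_comm]
      refine Finset.sum_eq_zero fun j _ => ?_
      rw [← Finset.mul_sum, hmom, mul_zero]
    have hnn : ∀ v ∈ Finset.univ, 0 ≤ y v * p.eval (t v) := fun v _ => by
      by_cases hv : y v = 0
      · rw [hv, zero_mul]
      · exact (hpos v hv).le
    exact (hpos v₀ hv₀).ne' ((Finset.sum_eq_zero_iff_of_nonneg hnn).1 hsum v₀ (Finset.mem_univ _))

end Moments

/-! ### The box complex -/

section Box

variable {V : Type*} [Fintype V] {G : SimpleGraph V}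

theorem mem_geomRealization_boxComplex {x : V ⊕ V → ℝ} :
    x ∈ geomRealization (boxComplex G) ↔ x ∈ stdSimplex ℝ (V ⊕ V) ∧
      ∀ v w, x (Sum.inl v) ≠ 0 → x (Sum.inr w) ≠ 0 → G.Adj v w := by
  classical
  constructor
  · rintro ⟨hx, σ, hσ, hs⟩
    exact ⟨hx, fun v w hv hw => hσ.2 v w (not_imp_comm.1 (hs _) hv) (not_imp_comm.1 (hs _) hw)⟩
  · rintro ⟨hx, h⟩
    refine ⟨hx, Finset.univ.filter fun i => x i ≠ 0, ⟨?_, fun v w hv hw => ?_⟩, fun i hi => ?_⟩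
    · by_contra hne
      rw [Finset.not_nonempty_iff_eq_empty, Finset.filter_eq_empty_iff] at hne
      have h1 := hx.2
      rw [Finset.sum_eq_zero fun i hi => not_not.1 (hne hi)] at h1
      exact zero_ne_one h1
    · exact h v w (Finset.mem_filter.1 hv).2 (Finset.mem_filter.1 hw).2
    · by_contra hne
      exact hi (Finset.mem_filter.2 ⟨Finset.mem_univ i, hne⟩)

theorem BoxSpace.continuous_apply (i : V ⊕ V) : Continuous fun x : BoxSpace G => x.1 i :=
  (_root_.continuous_apply i).comp
    (continuous_subtype_val (p := fun x => x ∈ geomRealization (boxComplex G)))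

/-- The signed weights of a point of the box complex. -/
def BoxSpace.weight (x : BoxSpace G) (v : V) : ℝ := x.1 (Sum.inl v) - x.1 (Sum.inr v)

theorem BoxSpace.weight_neg (x : BoxSpace G) (v : V) : (-x).weight v = -x.weight v := by
  show x.1 (Sum.inr v) - x.1 (Sum.inl v) = -(x.1 (Sum.inl v) - x.1 (Sum.inr v))
  ring

theorem BoxSpace.adj_of_weight_mul_neg (x : BoxSpace G) {v w : V}
    (h : x.weight v * x.weight w < 0) : G.Adj v w := by
  obtain ⟨hx, hadj⟩ := mem_geomRealization_boxComplex.1 x.2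
  have hpos : ∀ v, 0 < x.weight v → x.1 (Sum.inl v) ≠ 0 := fun v hv h0 => by
    have := hx.1 (Sum.inr v)
    simp only [weight] at hv
    linarith
  have hneg : ∀ v, x.weight v < 0 → x.1 (Sum.inr v) ≠ 0 := fun v hv h0 => by
    have := hx.1 (Sum.inl v)
    simp only [weight] at hv
    linarith
  rcases mul_neg_iff.1 h with ⟨h1, h2⟩ | ⟨h1, h2⟩
  · exact hadj v w (hpos v h1) (hneg w h2)
  · exact (hadj w v (hpos w h2) (hneg v h1)).symm

/-- Zero weight with nonzero coordinates would put both `+v` and `-v` in the support, which would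
make `v` adjacent to itself. -/
theorem BoxSpace.exists_weight_ne_zero (x : BoxSpace G) : ∃ v, x.weight v ≠ 0 := by
  obtain ⟨hx, hadj⟩ := mem_geomRealization_boxComplex.1 x.2
  by_contra! h
  have heq : ∀ v, x.1 (Sum.inl v) = x.1 (Sum.inr v) := fun v => sub_eq_zero.1 (h v)
  have hzero : ∀ v, x.1 (Sum.inl v) = 0 := fun v => by
    by_contra hv
    exact G.irrefl (hadj v v hv (heq v ▸ hv))
  have h1 := hx.2
  rw [Finset.sum_eq_zero fun i _ => ?_] at h1
  · exact zero_ne_one h1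
  · rcases i with v | v
    · exact hzero v
    · rw [← heq]
      exact hzero v

/-- An odd map from a sphere to the box complex forces, for every placement of the vertices on the
line that separates adjacent vertices, a long alternating sequence. -/
theorem exists_alternating_of_hasOddMap {d : ℕ} (h : HasOddMap (UnitSphere (d + 2)) (BoxSpace G))
    (t : V → ℝ) (ht : ∀ v w, G.Adj v w → t v ≠ t w) :
    ∃ (x : BoxSpace G) (c : ℕ → V), ∀ i ≤ d, t (c (i + 1)) < t (c i) ∧
      x.weight (c i) * x.weight (c (i + 1)) < 0 := by
  obtain ⟨f, hf, hodd⟩ := h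
  -- The odd map given by the first `d + 1` moments; `UnitSphere (d + 2)` has dimension `d + 1`, as
  -- Borsuk–Ulam requires.
  have hcont : Continuous fun (p : UnitSphere (d + 1 + 1)) (j : Fin (d + 1)) =>
      ∑ v, (f p).weight v * t v ^ (j : ℕ) := by
    refine continuous_pi fun j => continuous_finsetSum _ fun v _ => ?_
    refine Continuous.mul ?_ continuous_const
    exact ((BoxSpace.continuous_apply _).comp hf).sub ((BoxSpace.continuous_apply _).comp hf)
  obtain ⟨p, hp⟩ := UnitSphere.exists_zero_of_odd hcont fun p => by
    funext j
    simp only [hodd p, BoxSpace.weight_neg, Pi.neg_apply, neg_mul, Finset.sum_neg_distrib]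
  exact ⟨f p, exists_alternating_of_moments_eq_zero t (f p).weight d
    (f p).exists_weight_ne_zero (fun v w hvw => ht v w ((f p).adj_of_weight_mul_neg hvw))
    fun j => congrFun hp j⟩

end Box

/-! ### Circular colorings -/

section Coloring

theorem fact_pi_pos : Fact (0 < Real.pi) := ⟨Real.pi_pos⟩

attribute [local instance] fact_pi_pos

/-- The representative in `[0, π)` of a point of the circle of circumference `π`. -/
noncomputable def circleLift (a : AddCircle Real.pi) : ℝ := (AddCircle.equivIco Real.pi 0 a : ℝ)

theorem coe_circleLift (a : AddCircle Real.pi) : (circleLift a : AddCircle Real.pi) = a :=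
  AddCircle.coe_equivIco

theorem circleLift_nonneg (a : AddCircle Real.pi) : 0 ≤ circleLift a :=
  (AddCircle.equivIco Real.pi 0 a).2.1

theorem circleLift_zero : circleLift 0 = 0 := by
  have h := AddCircle.coe_equivIco_mk_apply Real.pi 0
  simpa [circleLift] using h

theorem dist_le_abs_circleLift (a b : AddCircle Real.pi) :
    dist a b ≤ |circleLift a - circleLift b| := by
  conv_lhs => rw [← coe_circleLift a, ← coe_circleLift b]
  rw [dist_eq_norm, ← AddCircle.coe_sub]
  exact QuotientAddGroup.norm_mk_le_norm

/-- The other arc between the two points, the one through the cut point, has this length. -/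
theorem dist_le_pi_sub_abs_circleLift (a b : AddCircle Real.pi) :
    dist a b ≤ Real.pi - |circleLift a - circleLift b| := by
  have key : ∀ a b : AddCircle Real.pi, circleLift b ≤ circleLift a →
      dist a b ≤ Real.pi - |circleLift a - circleLift b| := by
    intro a b hab
    have ha : circleLift a < 0 + Real.pi := (AddCircle.equivIco Real.pi 0 a).2.2
    have hb := circleLift_nonneg b
    rw [abs_of_nonneg (sub_nonneg.2 hab)]
    have h1 : dist a b = ‖((circleLift a - circleLift b - Real.pi : ℝ) : AddCircle Real.pi)‖ := by
      rw [AddCircle.coe_sub, AddCircle.coe_sub, AddCircle.coe_period, sub_zero, coe_circleLift,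
        coe_circleLift, dist_eq_norm]
    rw [h1]
    refine (QuotientAddGroup.norm_mk_le_norm).trans ?_
    rw [Real.norm_eq_abs, abs_of_nonpos (by linarith)]
    linarith
  rcases le_total (circleLift b) (circleLift a) with h | h
  · exact key a b h
  · rw [dist_comm, abs_sub_comm]
    exact key b a h

variable {V : Type*} [Fintype V] {G : SimpleGraph V} {r : ℝ} {f : V → AddCircle Real.pi}

/-- An odd map from a sphere to the box complex forces a long alternating sequence in every
circular coloring. -/
theorem IsCircularColoring.exists_alternating (hf : IsCircularColoring G r f) (hr : 0 < r) {d : ℕ}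
    (h : HasOddMap (UnitSphere (d + 2)) (BoxSpace G)) :
    ∃ (x : BoxSpace G) (c : ℕ → V),
      (∀ i ≤ d, circleLift (f (c (i + 1))) < circleLift (f (c i)) ∧
        x.weight (c i) * x.weight (c (i + 1)) < 0) ∧
      (d + 1) * (Real.pi / r) ≤ circleLift (f (c 0)) - circleLift (f (c (d + 1))) := by
  have hpos : 0 < Real.pi / r := div_pos Real.pi_pos hr
  obtain ⟨x, c, hc⟩ := exists_alternating_of_hasOddMap h (fun v => circleLift (f v))
    fun v w hvw heq => by
      have h1 := (hf v w hvw).trans (dist_le_abs_circleLift _ _)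
      rw [show circleLift (f v) = circleLift (f w) from heq, sub_self, abs_zero] at h1
      linarith
  have hgap : ∀ j : ℕ, j ≤ d + 1 →
      j * (Real.pi / r) ≤ circleLift (f (c 0)) - circleLift (f (c j)) := by
    intro j
    induction j with
    | zero => simp
    | succ j ih =>
      intro hj
      have h1 := ih (by omega)
      obtain ⟨h2, h3⟩ := hc j (by omega)
      have h4 := (hf _ _ (x.adj_of_weight_mul_neg h3)).trans (dist_le_abs_circleLift _ _)
      rw [abs_of_pos (sub_pos.2 h2)] at h4
      push_cast
      linarith
  refine ⟨x, c, hc, ?_⟩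
  have := hgap (d + 1) le_rfl
  push_cast at this
  exact this

theorem le_of_mul_pi_div_le {a : ℝ} (hr : 0 < r) (h : a * (Real.pi / r) ≤ Real.pi) : a ≤ r := by
  rw [mul_div_assoc', div_le_iff₀ hr, mul_comm] at h
  exact le_of_mul_le_mul_left h Real.pi_pos

theorem two_mul_le_circularChromaticNumber (k : ℕ)
    (h : HasOddMap (UnitSphere (2 * k)) (BoxSpace G)) :
    (2 * k : ℝ) ≤ circularChromaticNumber G := by
  refine le_csInf (circularColorableSet_nonempty G) ?_
  rintro r ⟨hr, f, hf⟩
  cases k with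
  | zero => simpa using hr.le
  | succ m =>
    obtain ⟨x, c, hc, hlong⟩ := hf.exists_alternating hr (d := 2 * m) h
    -- An odd number of sign changes separates `c 0` from `c (2 * j + 1)`. For `j = m` the ends of
    -- the sequence are therefore adjacent, which bounds the closing arc.
    have hsign : ∀ j ≤ m, x.weight (c 0) * x.weight (c (2 * j + 1)) < 0 := by
      intro j
      induction j with
      | zero => exact fun _ => (hc 0 (by omega)).2
      | succ j ih =>
        intro hj
        exact mul_neg_of_three_mul_neg (ih (by omega)) (hc (2 * j + 1) (by omega)).2
          (hc (2 * j + 1 + 1) (by omega)).2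
    have h1 := (hf _ _ (x.adj_of_weight_mul_neg (hsign m le_rfl))).trans
      (dist_le_pi_sub_abs_circleLift _ _)
    have h2 := le_abs_self (circleLift (f (c 0)) - circleLift (f (c (2 * m + 1))))
    refine le_of_mul_pi_div_le hr ?_
    push_cast at hlong ⊢
    linarith

theorem IsCircularColoring.sub_const {V : Type*} {G : SimpleGraph V} {f : V → AddCircle Real.pi}
    (hf : IsCircularColoring G r f) (a : AddCircle Real.pi) :
    IsCircularColoring G r fun v => f v - a := fun v w hvw => by
  rw [dist_sub_right]
  exact hf v w hvw

theorem two_mul_add_one_le_circularChromaticNumber_coneGraph (k : ℕ) (hk : 1 ≤ k ∨ Nonempty V)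
    (h : HasOddMap (UnitSphere (2 * k + 1)) (BoxSpace (coneGraph G))) :
    (2 * k + 1 : ℝ) ≤ circularChromaticNumber (coneGraph G) := by
  refine le_csInf (circularColorableSet_nonempty _) ?_
  rintro r ⟨hr, f₀, hf₀⟩
  -- Rotate the coloring so that the apex lies at the cut point `0`.
  have hf := hf₀.sub_const (f₀ none)
  set f : Option V → AddCircle Real.pi := fun v => f₀ v - f₀ none
  have hnone : circleLift (f none) = 0 := by
    simp only [f, sub_self]
    exact circleLift_zero
  have hadj : ∀ v, v ≠ none → (coneGraph G).Adj v none := by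
    rintro (_ | v) hv
    · exact absurd rfl hv
    · trivial
  have hpole : ∀ v, v ≠ none → Real.pi / r ≤ Real.pi - circleLift (f v) := fun v hv => by
    have h1 := (hf _ _ (hadj v hv)).trans (dist_le_pi_sub_abs_circleLift _ _)
    rwa [hnone, sub_zero, abs_of_nonneg (circleLift_nonneg _)] at h1
  refine le_of_mul_pi_div_le hr ?_
  cases k with
  | zero =>
    obtain ⟨v⟩ : Nonempty V := hk.resolve_left (by omega)
    have h1 := hpole (some v) (by simp)
    have h2 := circleLift_nonneg (f (some v))
    push_cast
    linarith
  | succ m =>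
    obtain ⟨x, c, hc, hlong⟩ := hf.exists_alternating hr (d := 2 * m + 1) h
    -- The top vertex lies strictly above another lift, so it is not the apex. Hence it is adjacent
    -- to the apex, and `hpole` adds one arc to the `2 * m + 2` gaps.
    have h0 : c 0 ≠ none := fun h0 => by
      have h1 := (hc 0 (by omega)).1
      rw [h0, hnone] at h1
      exact h1.not_ge (circleLift_nonneg _)
    have h1 := hpole _ h0
    have h2 := circleLift_nonneg (f (c (2 * m + 1 + 1)))
    push_cast at hlong ⊢
    linarith

end Coloring

/-! ### The box complex of a cone -/

section Cone

theorem mem_faces_boxComplex_coneGraph_iff {V : Type*} (G : SimpleGraph V)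
    (σ : Finset (Option V ⊕ Option V)) :
    σ ∈ (boxComplex (coneGraph G)).faces ↔
      σ.map (coneSignedVertexEquiv V).toEmbedding ∈
        (simplicialSuspension (boxComplex G)).faces := by
  classical
  set τ := σ.map (coneSignedVertexEquiv V).toEmbedding with hτ
  have hτne : τ.Nonempty ↔ σ.Nonempty := Finset.map_nonempty
  have hpos : ∀ v, Sum.inl v ∈ τ.toLeft ↔ Sum.inl (some v) ∈ σ := fun v => by
    rw [Finset.mem_toLeft, hτ, Finset.mem_map_equiv]
    rfl
  have hneg : ∀ v, Sum.inr v ∈ τ.toLeft ↔ Sum.inr (some v) ∈ σ := fun v => by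
    rw [Finset.mem_toLeft, hτ, Finset.mem_map_equiv]
    rfl
  have htrue : Sum.inr true ∈ τ ↔ Sum.inl none ∈ σ := by
    rw [hτ, Finset.mem_map_equiv]
    rfl
  have hfalse : Sum.inr false ∈ τ ↔ Sum.inr none ∈ σ := by
    rw [hτ, Finset.mem_map_equiv]
    rfl
  constructor
  · rintro ⟨hne, hadj⟩
    refine ⟨hτne.2 hne, ?_, fun h => hadj none none (htrue.1 h.1) (hfalse.1 h.2)⟩
    rcases Finset.eq_empty_or_nonempty τ.toLeft with h | h
    · exact Or.inl h
    · exact Or.inr ⟨h, fun v w hv hw => hadj (some v) (some w) ((hpos v).1 hv) ((hneg w).1 hw)⟩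
  · rintro ⟨hne, hleft, hpoles⟩
    refine ⟨hτne.1 hne, ?_⟩
    rintro (_ | v) (_ | w) hv hw
    · exact hpoles ⟨htrue.2 hv, hfalse.2 hw⟩
    · trivial
    · trivial
    · rcases hleft with h | h
      · have := (hpos v).2 hv
        rw [h] at this
        exact absurd this (Finset.notMem_empty _)
      · exact h.2 v w ((hpos v).2 hv) ((hneg w).2 hw)

theorem coneSignedVertexEquiv_swap {V : Type*} (x : Option V ⊕ Option V) :
    coneSignedVertexEquiv V x.swap = Sum.map Sum.swap not (coneSignedVertexEquiv V x) := by
  rcases x with (_ | v) | (_ | v) <;> rfl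

/-- This handles the poles of the suspension, where the radial extension is discontinuous but is
multiplied by a factor tending to zero. -/
theorem continuous_mul_of_bounded {X : Type*} [TopologicalSpace X] {a b : X → ℝ}
    (ha : Continuous a) (hb : ∀ x, |b x| ≤ 1) (hcont : ∀ x, a x ≠ 0 → ContinuousAt b x) :
    Continuous fun x => a x * b x := by
  rw [continuous_iff_continuousAt]
  intro x
  by_cases hx : a x = 0
  · have h0 : Filter.Tendsto (fun y => |a y|) (nhds x) (nhds 0) := by
      have := (ha.abs).tendsto x
      rwa [hx, abs_zero] at this
    rw [ContinuousAt, hx, zero_mul]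
    refine squeeze_zero_norm (fun y => ?_) h0
    rw [Real.norm_eq_abs, abs_mul]
    exact mul_le_of_le_one_right (abs_nonneg _) (hb y)
  · exact ha.continuousAt.mul (hcont x hx)

/-! ### Suspending an odd map -/

variable {V : Type*} [Fintype V] {G : SimpleGraph V} {n : ℕ}

/-- The projection of `ℝⁿ⁺¹` to its first `n` coordinates. -/
def dropLast (x : EuclideanSpace ℝ (Fin (n + 1))) : EuclideanSpace ℝ (Fin n) :=
  WithLp.toLp 2 fun i => x i.castSucc

theorem continuous_dropLast : Continuous (dropLast (n := n)) := by
  unfold dropLast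
  fun_prop

theorem norm_dropLast_sq (p : UnitSphere (n + 1)) :
    ‖dropLast p.1‖ ^ 2 + |p.1 (Fin.last n)| ^ 2 = 1 := by
  have h : ‖p.1‖ = 1 := mem_sphere_zero_iff_norm.1 p.2
  have h1 : ‖p.1‖ ^ 2 = 1 := by rw [h, one_pow]
  rw [EuclideanSpace.norm_sq_eq, Fin.sum_univ_castSucc] at h1
  rw [EuclideanSpace.norm_sq_eq]
  exact h1

theorem abs_last_le_one (p : UnitSphere (n + 1)) : |p.1 (Fin.last n)| ≤ 1 := by
  nlinarith [norm_dropLast_sq p, sq_nonneg ‖dropLast p.1‖, abs_nonneg (p.1 (Fin.last n))]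

theorem dropLast_ne_zero {p : UnitSphere (n + 1)} (h : 1 - |p.1 (Fin.last n)| ≠ 0) :
    dropLast p.1 ≠ 0 := fun h0 => by
  have h1 := norm_dropLast_sq p
  rw [h0, norm_zero, zero_pow two_ne_zero, zero_add,
    pow_eq_one_iff_of_nonneg (abs_nonneg _) two_ne_zero] at h1
  exact h (by rw [h1, sub_self])

open Classical in
/-- The radial extension of a map from the sphere to the box complex, with value zero at the
origin. -/
noncomputable def radialExtension (f : UnitSphere n → BoxSpace G)
    (y : EuclideanSpace ℝ (Fin n)) (i : V ⊕ V) : ℝ :=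
  if hy : y ≠ 0 then (f (UnitSphere.ofNeZero y hy)).1 i else 0

theorem radialExtension_of_ne_zero (f : UnitSphere n → BoxSpace G)
    {y : EuclideanSpace ℝ (Fin n)} (hy : y ≠ 0) :
    radialExtension f y = (f (UnitSphere.ofNeZero y hy)).1 := by
  funext i
  exact dif_pos hy

theorem radialExtension_zero (f : UnitSphere n → BoxSpace G) (i : V ⊕ V) :
    radialExtension f 0 i = 0 :=
  dif_neg (not_not.2 rfl)

theorem radialExtension_nonneg (f : UnitSphere n → BoxSpace G) (y : EuclideanSpace ℝ (Fin n))
    (i : V ⊕ V) : 0 ≤ radialExtension f y i := by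
  by_cases hy : y = 0
  · rw [hy, radialExtension_zero]
  · rw [radialExtension_of_ne_zero f hy]
    exact (mem_geomRealization_boxComplex.1 (f _).2).1.1 i

theorem radialExtension_le_one (f : UnitSphere n → BoxSpace G) (y : EuclideanSpace ℝ (Fin n))
    (i : V ⊕ V) : radialExtension f y i ≤ 1 := by
  by_cases hy : y = 0
  · rw [hy, radialExtension_zero]
    exact zero_le_one
  · rw [radialExtension_of_ne_zero f hy]
    have h := (mem_geomRealization_boxComplex.1 (f (UnitSphere.ofNeZero y hy)).2).1
    rw [← h.2]
    exact Finset.single_le_sum (fun j _ => h.1 j) (Finset.mem_univ i)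

theorem radialExtension_neg {f : UnitSphere n → BoxSpace G} (hf : Function.Odd f)
    (y : EuclideanSpace ℝ (Fin n)) (i : V ⊕ V) :
    radialExtension f (-y) i = radialExtension f y i.swap := by
  by_cases hy : y = 0
  · rw [hy, neg_zero, radialExtension_zero, radialExtension_zero]
  · rw [radialExtension_of_ne_zero f hy, radialExtension_of_ne_zero f (neg_ne_zero.2 hy),
      UnitSphere.ofNeZero_neg y hy, hf]
    rfl

theorem continuousOn_radialExtension {f : UnitSphere n → BoxSpace G} (hf : Continuous f)
    (i : V ⊕ V) : ContinuousOn (fun y => radialExtension f y i) {0}ᶜ := by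
  rw [continuousOn_iff_continuous_domRestrict]
  have hne : ∀ x : ({0}ᶜ : Set (EuclideanSpace ℝ (Fin n))), x.1 ≠ 0 := fun x =>
    Set.mem_compl_singleton_iff.1 x.2
  have heq : ({0}ᶜ : Set (EuclideanSpace ℝ (Fin n))).domRestrict
      (fun y => radialExtension f y i) = fun x => (f (UnitSphere.ofNeZero x.1 (hne x))).1 i := by
    funext x
    rw [Set.domRestrict_apply, radialExtension_of_ne_zero f (hne x)]
  rw [heq]
  exact (BoxSpace.continuous_apply i).comp
    (hf.comp (UnitSphere.continuous_ofNeZero continuous_subtype_val hne))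

/-- The coordinates of the suspension of a map from the sphere to the box complex. -/
noncomputable def suspensionCoord (f : UnitSphere n → BoxSpace G) (p : UnitSphere (n + 1)) :
    Option V ⊕ Option V → ℝ
  | Sum.inl none => max (p.1 (Fin.last n)) 0
  | Sum.inr none => max (-p.1 (Fin.last n)) 0
  | Sum.inl (some v) => (1 - |p.1 (Fin.last n)|) * radialExtension f (dropLast p.1) (Sum.inl v)
  | Sum.inr (some v) => (1 - |p.1 (Fin.last n)|) * radialExtension f (dropLast p.1) (Sum.inr v)

/-- With last coordinate `s`, one pole receives `|s|` and the image of the equatorial direction is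
scaled by `1 - |s|`, so the total weight is `1` and at most one pole is used. Where the direction is
undefined, `1 - |s| = 0`; this covers all of the sphere when `n = 0`. -/
theorem suspensionCoord_mem (f : UnitSphere n → BoxSpace G) (p : UnitSphere (n + 1)) :
    suspensionCoord f p ∈ geomRealization (boxComplex (coneGraph G)) := by
  have hp := abs_last_le_one p
  have hsusp : ∀ i, (1 - |p.1 (Fin.last n)|) * radialExtension f (dropLast p.1) i ≠ 0 →
      ∃ h : dropLast p.1 ≠ 0, (f (UnitSphere.ofNeZero _ h)).1 i ≠ 0 := fun i hi => by
    have h := dropLast_ne_zero (left_ne_zero_of_mul hi)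
    refine ⟨h, ?_⟩
    rw [← radialExtension_of_ne_zero f h]
    exact right_ne_zero_of_mul hi
  refine mem_geomRealization_boxComplex.2 ⟨⟨?_, ?_⟩, ?_⟩
  · rintro ((_ | v) | (_ | v))
    · exact le_max_right _ _
    · exact mul_nonneg (by linarith) (radialExtension_nonneg _ _ _)
    · exact le_max_right _ _
    · exact mul_nonneg (by linarith) (radialExtension_nonneg _ _ _)
  · rw [Fintype.sum_sum_type, Fintype.sum_option, Fintype.sum_option]
    simp only [suspensionCoord]
    rw [← Finset.mul_sum, ← Finset.mul_sum]
    have h1 : max (p.1 (Fin.last n)) 0 + max (-p.1 (Fin.last n)) 0 = |p.1 (Fin.last n)| :=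
      max_zero_add_max_neg_zero_eq_abs_self _
    have h2 : (1 - |p.1 (Fin.last n)|) * ∑ v, radialExtension f (dropLast p.1) (Sum.inl v) +
        (1 - |p.1 (Fin.last n)|) * ∑ v, radialExtension f (dropLast p.1) (Sum.inr v) =
        1 - |p.1 (Fin.last n)| := by
      by_cases h0 : 1 - |p.1 (Fin.last n)| = 0
      · rw [h0, zero_mul, zero_mul, add_zero]
      · have h := dropLast_ne_zero h0
        rw [← mul_add, ← Fintype.sum_sum_type, radialExtension_of_ne_zero f h,
          (mem_geomRealization_boxComplex.1 (f (UnitSphere.ofNeZero _ h)).2).1.2, mul_one]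
    linarith
  · rintro (_ | v) (_ | w) hv hw
    · simp only [suspensionCoord] at hv hw
      rcases le_total (p.1 (Fin.last n)) 0 with h | h
      · exact hv (max_eq_right h)
      · exact hw (max_eq_right (neg_nonpos.2 h))
    · trivial
    · trivial
    · obtain ⟨h, hv'⟩ := hsusp _ hv
      obtain ⟨_, hw'⟩ := hsusp _ hw
      exact (mem_geomRealization_boxComplex.1 (f (UnitSphere.ofNeZero _ h)).2).2 v w hv' hw'

theorem continuous_suspensionCoord {f : UnitSphere n → BoxSpace G} (hf : Continuous f) :
    Continuous (suspensionCoord f) := by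
  have hlast : Continuous fun p : UnitSphere (n + 1) => p.1 (Fin.last n) := by fun_prop
  have hside : ∀ i, Continuous fun p : UnitSphere (n + 1) =>
      (1 - |p.1 (Fin.last n)|) * radialExtension f (dropLast p.1) i := by
    intro i
    refine continuous_mul_of_bounded (continuous_const.sub hlast.abs) (fun p => ?_) fun p hp => ?_
    · rw [abs_of_nonneg (radialExtension_nonneg _ _ _)]
      exact radialExtension_le_one _ _ _
    -- Away from the poles the projection is nonzero, and there the radial extension is continuous.
    · refine ContinuousAt.comp (f := fun p : UnitSphere (n + 1) => dropLast p.1)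
        (g := fun y => radialExtension f y i) ?_
        (continuous_dropLast.comp continuous_subtype_val).continuousAt
      exact (continuousOn_radialExtension hf i).continuousAt
        (isOpen_compl_singleton.mem_nhds (dropLast_ne_zero hp))
  refine continuous_pi ?_
  rintro ((_ | v) | (_ | v))
  · exact hlast.max continuous_const
  · exact hside _
  · exact hlast.neg.max continuous_const
  · exact hside _

theorem suspensionCoord_neg {f : UnitSphere n → BoxSpace G} (hf : Function.Odd f)
    (p : UnitSphere (n + 1)) (i : Option V ⊕ Option V) :
    suspensionCoord f (-p) i = suspensionCoord f p i.swap := by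
  have h1 : (-p).1 (Fin.last n) = -p.1 (Fin.last n) := rfl
  have h2 : dropLast (-p).1 = -dropLast p.1 := rfl
  rcases i with (_ | v) | (_ | v) <;>
    simp only [suspensionCoord, Sum.swap_inl, Sum.swap_inr, h1, h2, neg_neg, abs_neg,
      radialExtension_neg hf]

theorem HasOddMap.suspension (h : HasOddMap (UnitSphere n) (BoxSpace G)) :
    HasOddMap (UnitSphere (n + 1)) (BoxSpace (coneGraph G)) := by
  obtain ⟨f, hf, hodd⟩ := h
  refine ⟨fun p => ⟨suspensionCoord f p, suspensionCoord_mem f p⟩,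
    Continuous.subtype_mk (continuous_suspensionCoord hf) _, fun p => ?_⟩
  apply Subtype.ext
  funext i
  exact suspensionCoord_neg hodd p i

end Cone

theorem mainTheorem7 {V : Type*} [Fintype V] (G : SimpleGraph V) :
    -- odd maps into the box complex of the cone bound its circular chromatic number
    (∀ k : ℕ, (1 ≤ k ∨ Nonempty V) →
      HasOddMap (UnitSphere (2 * k + 1)) (BoxSpace (coneGraph G)) →
        (2 * k + 1 : ℝ) ≤ circularChromaticNumber (coneGraph G)) ∧
    -- the box complex of the cone is the suspension of the box complex, compatibly with `ℤ/2`
    ((∀ σ : Finset (Option V ⊕ Option V), σ ∈ (boxComplex (coneGraph G)).faces ↔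
        σ.map (coneSignedVertexEquiv V).toEmbedding ∈
          (simplicialSuspension (boxComplex G)).faces) ∧
      ∀ x : Option V ⊕ Option V, coneSignedVertexEquiv V x.swap =
        Sum.map Sum.swap not (coneSignedVertexEquiv V x)) ∧
    -- passing to the cone raises the coindex of the box complex by at least one
    (∀ n : ℕ, HasOddMap (UnitSphere n) (BoxSpace G) →
      HasOddMap (UnitSphere (n + 1)) (BoxSpace (coneGraph G))) ∧
    -- odd maps from odd-dimensional spheres bound the circular chromatic number
    (∀ k : ℕ, HasOddMap (UnitSphere (2 * k)) (BoxSpace G) →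
      (2 * k : ℝ) ≤ circularChromaticNumber G) := by
  exact ⟨fun k hk h => two_mul_add_one_le_circularChromaticNumber_coneGraph k hk h,
    ⟨mem_faces_boxComplex_coneGraph_iff G, coneSignedVertexEquiv_swap⟩,
    fun _ h => h.suspension, fun k h => two_mul_le_circularChromaticNumber k h⟩
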